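/- **Setting.** Let $\mathbb R^4_2$ be $\mathbb R^4$ with $\langle V,W\rangle=V^1W^1+V^2W^2-V^3W^3-V^4W^4$ and let $\mathrm{AdS}_3=\{V:\langle V,V\rangle=-1\}$, time-oriented by the timelike field $T(V)=(0,0,V^4,-V^3)$ (a timelike tangent vector $w$ at $V$ is future directed if $\langle w,T(V)\rangle<0$). Let $M$ be a smooth surface, $F:M\to \mathrm{AdS}_3\subset\mathbb R^4_2$ a smooth spacelike immersion with induced metric $g$, and $\nu$ its future directed timelike unit normal in $\mathrm{AdS}_3$. Let $h_{ij}=-\langle \tilde A_{ij},\nu\rangle$, where $\tilde A$ is the second fundamental tensor of $M$ in $\mathbb R^4_2$, and let the principal curvatures $\lambda_1\le\lambda_2$ be the eigenvalues, with multiplicity, of the Weingarten map $g^{kl}h_{li}$. Orient $M$ so that $u,v\in T_pM$ is positively oriented if and only if $dF(u),dF(v),\nu,F$ is a positively oriented basis of $\mathbb R^4$. With the wedge products $e_i\wedge e_j\,(V,W)=V^iW^j-V^jW^i$ put $$\omega^1_\pm=e_2\wedge e_3\pm e_4\wedge e_1,\qquad \omega^2_\pm=e_1\wedge e_3\pm e_2\wedge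 e_4,\qquad \omega^3_\pm=e_1\wedge e_2\pm e_3\wedge e_4 ,$$ $\mathscr G^A_\pm=\frac1{\sqrt2}*(F^*\omega^A_\pm)$, where $*$ is the Hodge star of $(M,g)$, and $\mathscr G_\pm=(\mathscr G^1_\pm,\mathscr G^2_\pm,\mathscr G^3_\pm)$. The Gauss map is $\mathscr G=(\mathscr G_+,\mathscr G_-)$, with values in $Gr_2^+(2,4)=\mathbb H\times\mathbb H$, where $\mathbb H=\{V\in\mathbb R^3_1:\langle V,V\rangle=-\frac12,\ V^3>0\}$ and $\langle V,W\rangle=V^1W^1+V^2W^2-V^3W^3$. Let $\mathbb H\times\mathbb H$ carry the product metric and the complex structure $\mathscr J$ that is the rotation by $-\pi/2$ in the first factor and by $+\pi/2$ in the second one, where $\mathbb H$ is oriented by the projection to its first two coordinates. Let $\omega=\langle\mathscr J\cdot,\cdot\rangle$ be the Kähler form. For a smooth Lagrangian immersion $G:M\to\mathbb H\times\mathbb H$ let $\sigma$ be the induced metric, $D$ its connection, $\tau_{ijk}=\omega(D_iG,D_jD_kG)$ the second fundamental tensor, and $\tau=\tau_i\,dx^i$ with $\tau_i=\sigma^{jk}\tau_{ijk}$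 the mean curvature form. If $\tau$ is closed, then the Maslov class of $G$ is $[\tau/\pi]\in H^1_{dR}(M)$. A Lagrangian angle of $G$ is a smooth function $\phi$ on $M$ with $\tau=d\phi$. **Lemma A.2.** The Gauss map $\mathscr G$ of $F$ is a smooth Lagrangian immersion into $\mathbb H\times\mathbb H$, its mean curvature form $\tau$ is smooth and closed, and its Maslov class is trivial. The principal curvatures $\lambda_1\le\lambda_2$ of $F$ are real, and the function $\phi=\arctan\lambda_1+\arctan\lambda_2$ is a Lagrangian angle of $\mathscr G$; that is, $\phi$ is smooth and $\tau=d\phi$. -/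

import Mathlib

open scoped Manifold ContDiff

noncomputable section

namespace AdSGauss

/-! ### Calculus in two local coordinates -/

/-- The model space of a surface. -/
abbrev E2 := EuclideanSpace ℝ (Fin 2)

/-- The standard basis of the coordinate plane. -/
def basisVec (i : Fin 2) : E2 := EuclideanSpace.single i (1 : ℝ)

section Coordinates

variable {V : Type*} [NormedAddCommGroup V] [NormedSpace ℝ V]

/-- The partial derivative `∂ᵢ f`. -/
def pd (f : E2 → V) (i : Fin 2) (x : E2) : V := fderiv ℝ f x (basisVec i)

/-- The metric `B(∂ᵢ f, ∂ⱼ f)` induced by `f` from a form `B` on the ambient vector space. -/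
def inducedMetric (B : V → V → ℝ) (f : E2 → V) (x : E2) : Matrix (Fin 2) (Fin 2) ℝ :=
  Matrix.of fun i j => B (pd f i x) (pd f j x)

/-- The Christoffel symbol `Γᵏᵢⱼ` of a metric given in local coordinates. -/
def christoffel (g : E2 → Matrix (Fin 2) (Fin 2) ℝ) (x : E2) (k i j : Fin 2) : ℝ :=
  (1 / 2) * ∑ l, (g x)⁻¹ k l *
    (pd (fun y => g y j l) i x + pd (fun y => g y i l) j x - pd (fun y => g y i j) l x)

end Coordinates

/-! ### Anti-de Sitter space in `ℝ⁴₂` -/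

abbrev R4 := Fin 4 → ℝ

/-- The inner product of signature `(2, 2)` on `ℝ⁴`. -/
def ip4 (v w : R4) : ℝ := v 0 * w 0 + v 1 * w 1 - v 2 * w 2 - v 3 * w 3

/-- The anti-de Sitter space `{V ∈ ℝ⁴₂ : ⟨V, V⟩ = -1}`. -/
def AdS3 : Set R4 := {v | ip4 v v = -1}

/-- The timelike vector field on `AdS3` that defines its time orientation: a timelike tangent
vector `w` at `v` is future directed if `⟨w, timeField v⟩ < 0`. -/
def timeField (v : R4) : R4 := ![0, 0, v 3, -v 2]

/-! ### The Grassmannian of oriented spacelike planes as a product of hyperbolic planes -/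

abbrev R3 := Fin 3 → ℝ

/-- The Minkowski inner product on `ℝ³₁`. -/
def ip3 (v w : R3) : ℝ := v 0 * w 0 + v 1 * w 1 - v 2 * w 2

/-- The hyperbolic plane of curvature `-2`: the sheet `V³ > 0` of `⟨V, V⟩ = -1/2`. -/
def hyperbolicPlane : Set R3 := {v | ip3 v v = -(1 / 2) ∧ 0 < v 2}

/-- The Lorentzian vector product on `ℝ³₁`. -/
def lorentzCross (v w : R3) : R3 :=
  ![v 1 * w 2 - v 2 * w 1, v 2 * w 0 - v 0 * w 2, -(v 0 * w 1 - v 1 * w 0)]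

/-- The vector space containing `Gr₂⁺(2,4) = ℍ × ℍ`. -/
abbrev R33 := R3 × R3

/-- `Gr₂⁺(2,4)`, identified with the product of two hyperbolic planes of curvature `-2`. -/
def grassmannian : Set R33 := {P | P.1 ∈ hyperbolicPlane ∧ P.2 ∈ hyperbolicPlane}

/-- The product form on `ℝ³₁ × ℝ³₁`; on tangent vectors of `ℍ × ℍ` it is the product metric. -/
def ip33 (X Y : R33) : ℝ := ip3 X.1 Y.1 + ip3 X.2 Y.2

/-- The complex structure of `ℍ × ℍ` at the point `P`. It is the rotation by `-π/2` in the first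
and by `+π/2` in the second factor (each oriented by projection to the first two coordinates).
Equivalently, on `Hom(T, T^⊥)`, the tangent space of the Grassmannian at the oriented plane `T`, it
is the composition with the rotation by `-π/2` of the oriented plane `T^⊥`; at a tangent plane
of a spacelike surface in `AdS3` this rotation takes the position vector to the future unit normal.
-/
def complexJ (P X : R33) : R33 :=
  (-(Real.sqrt 2) • lorentzCross P.1 X.1, Real.sqrt 2 • lorentzCross P.2 X.2)

/-- The Kähler form `ω = ⟨J ·, ·⟩` at the point `P`. -/
def kahlerForm (P X Y : R33) : ℝ := ip33 (complexJ P X) Y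

/-- The orthogonal projection of `ℝ³₁` to the tangent space of the hyperbolic plane at `v`. -/
def projH (v X : R3) : R3 := X + (2 * ip3 X v) • v

/-- The orthogonal projection to the tangent space of `ℍ × ℍ` at `P`. -/
def projGr (P X : R33) : R33 := (projH P.1 X.1, projH P.2 X.2)

/-! ### Differential forms of degree one on a surface -/

section Forms

variable (M : Type*) [TopologicalSpace M] [ChartedSpace E2 M]

/-- (Not necessarily continuous) `1`-forms on the surface `M`. -/
def OneForm := (p : M) → TangentSpace (𝓡 2) p →L[ℝ] ℝ

instance : AddCommGroup (OneForm M) :=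
  inferInstanceAs (AddCommGroup ((p : M) → TangentSpace (𝓡 2) p →L[ℝ] ℝ))

instance : Module ℝ (OneForm M) :=
  inferInstanceAs (Module ℝ ((p : M) → TangentSpace (𝓡 2) p →L[ℝ] ℝ))

variable {M}

/-- The expression of a `1`-form in the chart `e`, i.e. its pullback under `e⁻¹`. -/
def OneForm.inChart (θ : OneForm M) (e : OpenPartialHomeomorph M E2) (x : E2) : E2 →L[ℝ] ℝ :=
  (θ (e.symm x)).comp (mfderiv (𝓡 2) (𝓡 2) e.symm x)

/-- Smooth closed `1`-forms: in every chart the form is smooth and its exterior derivative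
`dθ(u, v) = D_u θ(v) - D_v θ(u)` vanishes. -/
def IsSmoothClosed (θ : OneForm M) : Prop :=
  ∀ e ∈ atlas E2 M, ContDiffOn ℝ ∞ (OneForm.inChart θ e) e.target ∧
    ∀ x ∈ e.target, ∀ u v : E2,
      fderiv ℝ (OneForm.inChart θ e) x u v - fderiv ℝ (OneForm.inChart θ e) x v u = 0

variable (M)

/-- The vector space of smooth closed `1`-forms. -/
def closedForms : Submodule ℝ (OneForm M) where
  carrier := {θ | IsSmoothClosed θ}
  zero_mem' := by
    intro e he
    have h0 : OneForm.inChart (0 : OneForm M) e = fun _ => 0 := by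
      funext x; ext v; rfl
    rw [h0]
    refine ⟨contDiffOn_const, fun x _ u v => ?_⟩
    simp
  add_mem' := by
    intro a b ha hb e he
    obtain ⟨ha1, ha2⟩ := ha e he
    obtain ⟨hb1, hb2⟩ := hb e he
    have h0 : OneForm.inChart (a + b) e = OneForm.inChart a e + OneForm.inChart b e := by
      funext x; ext v; rfl
    rw [h0]
    refine ⟨ha1.add hb1, fun x hx u v => ?_⟩
    have hn := e.open_target.mem_nhds hx
    have hda := (ha1.contDiffAt hn).differentiableAt (by simp)
    have hdb := (hb1.contDiffAt hn).differentiableAt (by simp)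
    rw [fderiv_add hda hdb]
    have h1 := ha2 x hx u v
    have h2 := hb2 x hx u v
    simp only [add_apply]
    linarith
  smul_mem' := by
    intro c a ha e he
    obtain ⟨ha1, ha2⟩ := ha e he
    have h0 : OneForm.inChart (c • a) e = c • OneForm.inChart a e := by
      funext x; ext v; rfl
    rw [h0]
    refine ⟨contDiffOn_const.smul ha1, fun x hx u v => ?_⟩
    have hn := e.open_target.mem_nhds hx
    have hda := (ha1.contDiffAt hn).differentiableAt (by simp)
    rw [fderiv_const_smul hda]
    have h1 := ha2 x hx u v
    simp only [smul_apply, smul_eq_mul]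
    rw [← mul_sub, h1, mul_zero]

/-- The vector space of exact `1`-forms `df`, with `f` a smooth function. -/
def exactForms : Submodule ℝ (OneForm M) where
  carrier := {θ | ∃ f : M → ℝ, ContMDiff (𝓡 2) 𝓘(ℝ, ℝ) ∞ f ∧ mvfderiv (𝓡 2) f = θ}
  zero_mem' := ⟨0, contMDiff_const, by funext x; exact mvfderiv_zero⟩
  add_mem' := by
    rintro _ _ ⟨f, hf, rfl⟩ ⟨g, hg, rfl⟩
    refine ⟨f + g, hf.add hg, ?_⟩
    funext x
    exact mvfderiv_add ((hf x).mdifferentiableAt (by simp)) ((hg x).mdifferentiableAt (by simp))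
  smul_mem' := by
    rintro c _ ⟨f, hf, rfl⟩
    have hc : ContMDiff (𝓡 2) 𝓘(ℝ, ℝ) ∞ (fun _ : M => c) := contMDiff_const
    refine ⟨fun x => c • f x, hc.smul hf, ?_⟩
    funext x
    have h := mvfderiv_smul (I := 𝓡 2) (x := x) (a := fun _ : M => c) mdifferentiableAt_const
      ((hf x).mdifferentiableAt (by simp))
    rw [mvfderiv_const] at h
    refine h.trans ?_
    ext v
    simp only [add_apply, ContinuousLinearMap.smulRight_apply, zero_apply, zero_smul, add_zero]
    rfl

/-- The first de Rham cohomology group: smooth closed `1`-forms modulo exact `1`-forms. -/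
abbrev DeRhamH1 := closedForms M ⧸ (exactForms M).submoduleOf (closedForms M)

end Forms

/-! ### Spacelike surfaces -/

section Surfaces

variable {M : Type*} [TopologicalSpace M] [ChartedSpace E2 M]

/-- The local expression of a map on `M` in the preferred chart around `p`. The tangent space
`T_p M` is identified with `ℝ²` by this chart. -/
def localRep {V : Type*} (f : M → V) (p : M) : E2 → V := fun x => f ((chartAt E2 p).symm x)

/-- The coordinates of `p` in the preferred chart around `p`. -/
def basePt (p : M) : E2 := chartAt E2 p p

/-- Smooth spacelike immersions of the surface `M` into `AdS3`, as maps to `ℝ⁴₂`: the pullback of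
the ambient inner product is positive definite (so that `F` is automatically an immersion). -/
structure IsSpacelikeImmersion (F : M → R4) : Prop where
  smooth : ContMDiff (𝓡 2) 𝓘(ℝ, R4) ∞ F
  mem_AdS3 : ∀ p, F p ∈ AdS3
  spacelike : ∀ (p : M) (v : TangentSpace (𝓡 2) p), v ≠ 0 →
    0 < ip4 (mvfderiv (𝓡 2) F p v) (mvfderiv (𝓡 2) F p v)

/-- `ν` is the future directed timelike unit normal of the surface within `AdS3`. -/
structure IsFutureUnitNormal (F ν : M → R4) : Prop where
  unit : ∀ p, ip4 (ν p) (ν p) = -1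
  tangent_AdS3 : ∀ p, ip4 (ν p) (F p) = 0
  normal : ∀ (p : M) (v : TangentSpace (𝓡 2) p), ip4 (ν p) (mvfderiv (𝓡 2) F p v) = 0
  future : ∀ p, ip4 (ν p) (timeField (F p)) < 0

/-- The first fundamental form `gᵢⱼ` at `p`, in the preferred chart. -/
def firstFundamentalForm (F : M → R4) (p : M) : Matrix (Fin 2) (Fin 2) ℝ :=
  inducedMetric ip4 (localRep F p) (basePt p)

/-- The second fundamental tensor `Ãᵢⱼ = ∂ᵢ∂ⱼF - Γᵏᵢⱼ ∂ₖF` of the surface in `ℝ⁴₂`. -/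
def secondFundamentalTensor (F : M → R4) (p : M) (i j : Fin 2) : R4 :=
  let f := localRep F p
  let x := basePt p
  pd (pd f j) i x - ∑ k, christoffel (inducedMetric ip4 f) x k i j • pd f k x

/-- The second fundamental form `hᵢⱼ = -⟨Ãᵢⱼ, ν⟩`; since `Ãᵢⱼ = gᵢⱼ F + hᵢⱼ ν`, this is the second
fundamental form of the surface in `AdS3` with respect to `ν`. -/
def secondFundamentalForm (F ν : M → R4) (p : M) : Matrix (Fin 2) (Fin 2) ℝ :=
  Matrix.of fun i j => -ip4 (secondFundamentalTensor F p i j) (ν p)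

/-- The matrix `Wᵏᵢ = gᵏˡ hₗᵢ` of the Weingarten map at `p`. -/
def weingarten (F ν : M → R4) (p : M) : Matrix (Fin 2) (Fin 2) ℝ :=
  (firstFundamentalForm F p)⁻¹ * secondFundamentalForm F ν p

/-- The principal curvatures at `p`: the eigenvalues of the Weingarten map with multiplicity. -/
def principalCurvatures (F ν : M → R4) (p : M) : Multiset ℝ :=
  (weingarten F ν p).charpoly.roots

/-! ### The Gauss map -/

/-- The `2`-form `eᵢ ∧ eⱼ` on `ℝ⁴`. -/
def wedge (i j : Fin 4) (v w : R4) : ℝ := v i * w j - v j * w i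

/-- The forms `ω¹₊, ω²₊, ω³₊` (for `s = 1`) and `ω¹₋, ω²₋, ω³₋` (for `s = -1`). -/
def omega (s : ℝ) (A : Fin 3) (v w : R4) : ℝ :=
  ![wedge 1 2 v w + s * wedge 3 0 v w,
    wedge 0 2 v w + s * wedge 1 3 v w,
    wedge 0 1 v w + s * wedge 2 3 v w] A

/-- The value of the Riemannian area form of the induced metric on the coordinate basis of `T_p M`,
for the orientation of `M` in which a basis `u, v` is positive if and only if the vectors
`dF(u), dF(v), ν, F` form a positively oriented basis of `ℝ⁴`. -/
def areaOfBasis (F ν : M → R4) (p : M) : ℝ :=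
  SignType.sign (Matrix.det (Matrix.of ![mvfderiv (𝓡 2) F p (basisVec 0),
    mvfderiv (𝓡 2) F p (basisVec 1), ν p, F p])) *
  Real.sqrt (firstFundamentalForm F p).det

/-- `(1/√2) *(F^* β)` for a `2`-form `β` on `ℝ⁴`, where the Hodge star `*α` of a `2`-form `α` on
the oriented Riemannian surface `M` is the quotient of `α` by the area form. -/
def gaussComponent (F ν : M → R4) (β : R4 → R4 → ℝ) (p : M) : ℝ :=
  (1 / Real.sqrt 2) *
    (β (mvfderiv (𝓡 2) F p (basisVec 0)) (mvfderiv (𝓡 2) F p (basisVec 1)) / areaOfBasis F ν p)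

/-- The Gauss map `(𝒢₊, 𝒢₋)` of a spacelike surface. -/
def gaussMap (F ν : M → R4) (p : M) : R33 :=
  (fun A => gaussComponent F ν (omega 1 A) p, fun A => gaussComponent F ν (omega (-1) A) p)

/-! ### Lagrangian immersions into the Grassmannian -/

/-- Smooth Lagrangian immersions of the surface `M` into `Gr₂⁺(2,4) = ℍ × ℍ`. -/
structure IsLagrangianImmersion (G : M → R33) : Prop where
  smooth : ContMDiff (𝓡 2) 𝓘(ℝ, R33) ∞ G
  mem_grassmannian : ∀ p, G p ∈ grassmannian
  immersion : ∀ p, Function.Injective (mvfderiv (𝓡 2) G p)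
  lagrangian : ∀ (p : M) (u v : TangentSpace (𝓡 2) p),
    kahlerForm (G p) (mvfderiv (𝓡 2) G p u) (mvfderiv (𝓡 2) G p v) = 0

/-- The metric `σᵢⱼ` induced by `G`, at `p` in the preferred chart. -/
def lagMetric (G : M → R33) (p : M) : Matrix (Fin 2) (Fin 2) ℝ :=
  inducedMetric ip33 (localRep G p) (basePt p)

/-- `DⱼDₖG = (∂ⱼ∂ₖG)^⊤ - Γˡⱼₖ ∂ₗG`, where `⊤` is the projection to the tangent space of `ℍ × ℍ`
and `Γ` are the Christoffel symbols of `σ`. -/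
def lagHessian (G : M → R33) (p : M) (j k : Fin 2) : R33 :=
  let f := localRep G p
  let x := basePt p
  projGr (G p) (pd (pd f k) j x) - ∑ l, christoffel (inducedMetric ip33 f) x l j k • pd f l x

/-- The second fundamental tensor `τᵢⱼₖ = ω(DᵢG, DⱼDₖG)`. -/
def lagSecondFundamental (G : M → R33) (p : M) (i j k : Fin 2) : ℝ :=
  kahlerForm (G p) (pd (localRep G p) i (basePt p)) (lagHessian G p j k)

/-- The component `τᵢ = σʲᵏ τᵢⱼₖ` of the mean curvature form. -/
def meanCurvatureCoeff (G : M → R33) (p : M) (i : Fin 2) : ℝ :=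
  ∑ j, ∑ k, (lagMetric G p)⁻¹ j k * lagSecondFundamental G p i j k

/-- The mean curvature form `τ = τᵢ dxⁱ`. -/
def meanCurvatureForm (G : M → R33) : OneForm M := fun p =>
  ∑ i : Fin 2, meanCurvatureCoeff G p i • (EuclideanSpace.proj i : E2 →L[ℝ] ℝ)

/-- The Maslov class: the class of `τ / π` in the first de Rham cohomology group. -/
def maslovClass (G : M → R33) (h : meanCurvatureForm G ∈ closedForms M) : DeRhamH1 M :=
  Submodule.Quotient.mk ⟨Real.pi⁻¹ • meanCurvatureForm G, (closedForms M).smul_mem _ h⟩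

/-- `φ` is a Lagrangian angle of `G`: a smooth function with `τ = dφ`. -/
def IsLagrangianAngle (G : M → R33) (φ : M → ℝ) : Prop :=
  ContMDiff (𝓡 2) 𝓘(ℝ, ℝ) ∞ φ ∧ meanCurvatureForm G = mvfderiv (𝓡 2) φ

end Surfaces

end AdSGauss

end

noncomputable section

namespace AdSGauss

/-! The forms `ω±` are, up to sign, (anti-)self-dual, so the bivector of the tangent plane can be
replaced by that of the oriented normal plane: the Gauss map is `normalPoint ν F`
(`gaussMap_eq_normalPoint`). This is bilinear in `ν` and `F`, hence the product rule computes
everything. Write `g` for the first and `h` for the second fundamental form, and `W = g⁻¹h`. The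
induced metric is `σ = g + h g⁻¹ h`, and `ω(∂ᵢ𝒢, ∂ⱼ𝒢) = hᵢⱼ - hⱼᵢ = 0`, so the Lagrangian property
is the symmetry of `h`. The immersion property holds because `dν` is tangent to a spacelike plane
and `σ ≥ g`. By the Codazzi equation, `τᵢⱼₖ = ∇ᵢhⱼₖ`, with the connection of `g`.

The angle comes from `det (g + ih) = det g (1 + iλ₁)(1 + iλ₂)`, which is `angleNumber g h`. Since
`∇g = 0`, the logarithmic derivative of this determinant is `i tr ((g + ih)⁻¹ ∇ᵢh)`. Its imaginary
part is `tr (σ⁻¹ ∇ᵢh)`, because `Re (g + ih)⁻¹ = (1 + W²)⁻¹ g⁻¹ = σ⁻¹`. Thus `τ = d arg det (g +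
ih)`; `trace_identity` is the coordinate form and `meanCurvature_eq_pd_arg` the result.

Both factors `1 + iλ` lie in the right half plane, so their product avoids the negative real axis
and its principal argument is `arctan λ₁ + arctan λ₂` (`exists_eigenvalues`). Hence this sum is
smooth even at umbilics, where the individual `λ` need not be. A change of chart multiplies the
determinant by a positive number, so the angle is global; `τ` is exact, and therefore closed with
trivial Maslov class. -/

/-! ### Linear algebra of `ℝ⁴₂` and `ℝ³₁` -/

/-- The determinant of four vectors of `ℝ⁴`. -/
def det4 (a b c d : R4) : ℝ := Matrix.det (Matrix.of ![a, b, c, d])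

/-- The inner product of `ℝ⁴₂` as a bilinear map. -/
def ip4Bilin : R4 →ₗ[ℝ] R4 →ₗ[ℝ] ℝ :=
  LinearMap.mk₂ ℝ ip4
    (fun u v w => by simp only [ip4, Pi.add_apply]; ring)
    (fun c v w => by simp only [ip4, Pi.smul_apply, smul_eq_mul]; ring)
    (fun u v w => by simp only [ip4, Pi.add_apply]; ring)
    (fun c v w => by simp only [ip4, Pi.smul_apply, smul_eq_mul]; ring)

lemma ip4_comm (v w : R4) : ip4 v w = ip4 w v := by simp only [ip4]; ring

lemma ip4_add_left (u v w : R4) : ip4 (u + v) w = ip4 u w + ip4 v w := by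
  simp only [ip4, Pi.add_apply]; ring

lemma ip4_add_right (u v w : R4) : ip4 u (v + w) = ip4 u v + ip4 u w := by
  simp only [ip4, Pi.add_apply]; ring

lemma ip4_sub_left (u v w : R4) : ip4 (u - v) w = ip4 u w - ip4 v w := by
  simp only [ip4, Pi.sub_apply]; ring

lemma ip4_smul_left (c : ℝ) (v w : R4) : ip4 (c • v) w = c * ip4 v w := by
  simp only [ip4, Pi.smul_apply, smul_eq_mul]; ring

lemma ip4_smul_right (c : ℝ) (v w : R4) : ip4 v (c • w) = c * ip4 v w := by
  simp only [ip4, Pi.smul_apply, smul_eq_mul]; ring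

lemma ip4_single (v : R4) :
    ip4 v (Pi.single 0 1) = v 0 ∧ ip4 v (Pi.single 1 1) = v 1 ∧
      ip4 v (Pi.single 2 1) = -v 2 ∧ ip4 v (Pi.single 3 1) = -v 3 := by
  simp [ip4]

/-- The product of two determinants is the determinant of the inner products. -/
lemma det4_mul_det4 (a b c d a' b' c' d' : R4) :
    det4 a b c d * det4 a' b' c' d' = Matrix.det (Matrix.of fun i j : Fin 4 =>
      ip4 (![a, b, c, d] i) (![a', b', c', d'] j)) := by
  have h : (Matrix.of fun i j : Fin 4 => ip4 (![a, b, c, d] i) (![a', b', c', d'] j)) =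
      Matrix.of ![a, b, c, d] * Matrix.diagonal ![1, 1, -1, -1] *
        (Matrix.of ![a', b', c', d']).transpose := by
    ext i j
    simp only [Matrix.of_apply, Matrix.mul_apply, Matrix.transpose_apply,
      Fin.sum_univ_four, ip4]
    simp
    ring
  rw [h, Matrix.det_mul, Matrix.det_mul, Matrix.det_transpose, Matrix.det_diagonal]
  simp [Fin.prod_univ_four, det4]

lemma det_fin_four (A : Matrix (Fin 4) (Fin 4) ℝ) :
    A.det =
      A 0 0 * (A 1 1 * (A 2 2 * A 3 3 - A 2 3 * A 3 2) - A 1 2 * (A 2 1 * A 3 3 - A 2 3 * A 3 1)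
        + A 1 3 * (A 2 1 * A 3 2 - A 2 2 * A 3 1)) -
      A 0 1 * (A 1 0 * (A 2 2 * A 3 3 - A 2 3 * A 3 2) - A 1 2 * (A 2 0 * A 3 3 - A 2 3 * A 3 0)
        + A 1 3 * (A 2 0 * A 3 2 - A 2 2 * A 3 0)) +
      A 0 2 * (A 1 0 * (A 2 1 * A 3 3 - A 2 3 * A 3 1) - A 1 1 * (A 2 0 * A 3 3 - A 2 3 * A 3 0)
        + A 1 3 * (A 2 0 * A 3 1 - A 2 1 * A 3 0)) -
      A 0 3 * (A 1 0 * (A 2 1 * A 3 2 - A 2 2 * A 3 1) - A 1 1 * (A 2 0 * A 3 2 - A 2 2 * A 3 0)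
        + A 1 2 * (A 2 0 * A 3 1 - A 2 1 * A 3 0)) := by
  rw [Matrix.det_succ_row_zero, Fin.sum_univ_four]
  simp only [Matrix.det_fin_three, Matrix.submatrix_apply]
  simp [Fin.succAbove, Fin.lt_def]
  ring

lemma det4_eq (a b c d : R4) : det4 a b c d =
      a 0 * (b 1 * (c 2 * d 3 - c 3 * d 2) - b 2 * (c 1 * d 3 - c 3 * d 1)
        + b 3 * (c 1 * d 2 - c 2 * d 1)) -
      a 1 * (b 0 * (c 2 * d 3 - c 3 * d 2) - b 2 * (c 0 * d 3 - c 3 * d 0)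
        + b 3 * (c 0 * d 2 - c 2 * d 0)) +
      a 2 * (b 0 * (c 1 * d 3 - c 3 * d 1) - b 1 * (c 0 * d 3 - c 3 * d 0)
        + b 3 * (c 0 * d 1 - c 1 * d 0)) -
      a 3 * (b 0 * (c 1 * d 2 - c 2 * d 1) - b 1 * (c 0 * d 2 - c 2 * d 0)
        + b 2 * (c 0 * d 1 - c 1 * d 0)) := by
  rw [det4, det_fin_four]
  simp

/-! ### Normal frames of spacelike planes -/

/-- `n, x` is an orthonormal basis of the timelike normal plane of the plane spanned
by `a, b`. -/
structure IsNormalFrame (a b n x : R4) : Prop where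
  nn : ip4 n n = -1
  xx : ip4 x x = -1
  nx : ip4 n x = 0
  na : ip4 n a = 0
  nb : ip4 n b = 0
  xa : ip4 x a = 0
  xb : ip4 x b = 0

namespace IsNormalFrame

variable {a b n x : R4} (h : IsNormalFrame a b n x)
include h

lemma xn : ip4 x n = 0 := by rw [ip4_comm, h.nx]
lemma an : ip4 a n = 0 := by rw [ip4_comm, h.na]
lemma bn : ip4 b n = 0 := by rw [ip4_comm, h.nb]
lemma ax : ip4 a x = 0 := by rw [ip4_comm, h.xa]
lemma bx : ip4 b x = 0 := by rw [ip4_comm, h.xb]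

/-- The Gram matrix is in block form: `a, b` are orthogonal to `n, x`, and the block of `n, x` is
minus the identity, of determinant 1. For coordinate vectors `u, v` this identifies the Plücker
coordinates of `a ∧ b` with complementary ones of `n ∧ x`. -/
lemma det4_mul_det4_normal (u v : R4) :
    det4 a b n x * det4 n x u v = ip4 a u * ip4 b v - ip4 a v * ip4 b u := by
  rw [det4_mul_det4, det_fin_four]
  simp [h.nn, h.xx, h.nx, h.xn, h.an, h.bn, h.ax, h.bx]

lemma det4_sq : det4 a b n x ^ 2 = ip4 a a * ip4 b b - ip4 a b ^ 2 := by
  rw [sq, det4_mul_det4, det_fin_four]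
  simp [h.nn, h.xx, h.nx, h.xn, h.an, h.bn, h.ax, h.bx, h.na, h.nb, h.xa, h.xb]
  rw [ip4_comm b a]
  ring

/-- The forms `ω±` are (anti-)self-dual. -/
lemma omega_tangent (s : ℝ) (hs : s ^ 2 = 1) (A : Fin 3) :
    omega s A a b = s * det4 a b n x * omega s A n x := by
  have key := h.det4_mul_det4_normal
  obtain ⟨a0, a1, a2, a3⟩ := ip4_single a
  obtain ⟨b0, b1, b2, b3⟩ := ip4_single b
  have k01 := key (Pi.single 0 1) (Pi.single 1 1)
  have k02 := key (Pi.single 0 1) (Pi.single 2 1)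
  have k03 := key (Pi.single 0 1) (Pi.single 3 1)
  have k12 := key (Pi.single 1 1) (Pi.single 2 1)
  have k13 := key (Pi.single 1 1) (Pi.single 3 1)
  have k23 := key (Pi.single 2 1) (Pi.single 3 1)
  rw [det4_eq n x] at k01 k02 k03 k12 k13 k23
  simp [a0, a1, a2, a3, b0, b1, b2, b3] at k01 k02 k03 k12 k13 k23
  fin_cases A
  · simp [omega, wedge]
    linear_combination k12 - s * k03 -
      det4 a b n x * (n 3 * x 0 - n 0 * x 3) * hs
  · simp [omega, wedge]
    linear_combination k02 + s * k13 - det4 a b n x * (n 1 * x 3 - n 3 * x 1) * hs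
  · simp [omega, wedge]
    linear_combination -k01 - s * k23 -
      det4 a b n x * (n 2 * x 3 - n 3 * x 2) * hs

/-- A vector orthogonal to all vectors of the frame vanishes. -/
lemma eq_zero (hd : ip4 a a * ip4 b b - ip4 a b ^ 2 ≠ 0) {v : R4} (ha : ip4 v a = 0)
    (hb : ip4 v b = 0) (hn : ip4 v n = 0) (hx : ip4 v x = 0) : v = 0 := by
  have hD : det4 a b n x ≠ 0 := by
    intro h0
    rw [← h.det4_sq, h0] at hd
    simp at hd
  have key : (Matrix.of ![a, b, n, x]).mulVec ![v 0, v 1, -v 2, -v 3] = 0 := by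
    ext i
    fin_cases i <;> simp only [ip4] at ha hb hn hx <;>
      simp [Matrix.mulVec, dotProduct, Fin.sum_univ_four] <;> linarith
  have := Matrix.eq_zero_of_mulVec_eq_zero hD key
  ext i
  have hi := congrFun this i
  fin_cases i <;> simpa using hi

end IsNormalFrame

/-! ### Bivectors and the geometry of the two hyperbolic factors -/

/-- The value `(ω¹(v, w), ω²(v, w), ω³(v, w))` of the wedge products. -/
def bivector (s : ℝ) (v w : R4) : R3 := fun A => omega s A v w

/-- The vector of `ℝ³₁ × ℝ³₁` that corresponds to the normal bivector `v ∧ w`. -/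
def normalPoint (v w : R4) : R33 :=
  ((1 / √2) • bivector 1 v w, -(1 / √2) • bivector (-1) v w)

/-- `normalPoint` as a bilinear map. -/
def normalPointBilin : R4 →ₗ[ℝ] R4 →ₗ[ℝ] R33 :=
  LinearMap.mk₂ ℝ normalPoint
    (fun u v w => by
      ext A <;> fin_cases A <;> simp [normalPoint, bivector, omega, wedge] <;> ring)
    (fun c v w => by
      ext A <;> fin_cases A <;> simp [normalPoint, bivector, omega, wedge] <;> ring)
    (fun u v w => by
      ext A <;> fin_cases A <;> simp [normalPoint, bivector, omega, wedge] <;> ring)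
    (fun c v w => by
      ext A <;> fin_cases A <;> simp [normalPoint, bivector, omega, wedge] <;> ring)

lemma normalPoint_swap (v w : R4) : normalPoint v w = -normalPoint w v := by
  ext A <;> fin_cases A <;> simp [normalPoint, bivector, omega, wedge] <;> ring

lemma inv_sqrt_two_sq : (√2)⁻¹ * (√2)⁻¹ = (1 / 2 : ℝ) := by
  rw [← mul_inv, Real.mul_self_sqrt (by norm_num)]; norm_num

/-- The self-dual and anti-self-dual parts split the bivectors orthogonally, so adding the two
factors recovers minus the inner product of `ℝ⁴₂` on bivectors; the factors `1/√2` normalize it. -/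
lemma ip33_normalPoint (a b c d : R4) :
    ip33 (normalPoint a b) (normalPoint c d) = -(ip4 a c * ip4 b d - ip4 a d * ip4 b c) := by
  have h := inv_sqrt_two_sq
  simp only [ip33, ip3, normalPoint, bivector, omega, wedge, one_div, Pi.smul_apply,
    smul_eq_mul, Matrix.cons_val]
  generalize (√2)⁻¹ = r at h
  simp only [ip4]
  linear_combination (-2 * ((a 0 * c 0 + a 1 * c 1 - a 2 * c 2 - a 3 * c 3) *
    (b 0 * d 0 + b 1 * d 1 - b 2 * d 2 - b 3 * d 3) -
    (a 0 * d 0 + a 1 * d 1 - a 2 * d 2 - a 3 * d 3) *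
    (b 0 * c 0 + b 1 * c 1 - b 2 * c 2 - b 3 * c 3))) * h

/-- This is the splitting of `so(2,2)` into two copies of `sl(2,ℝ)`: the vector product in each
factor is the commutator of bivectors. The formula is the same for both signs. -/
lemma lorentzCross_bivector {s : ℝ} (hs : s = 1 ∨ s = -1) (a b c d : R4) :
    lorentzCross (bivector s a b) (bivector s c d) =
      -(ip4 a c • bivector s b d - ip4 a d • bivector s b c -
        ip4 b c • bivector s a d + ip4 b d • bivector s a c) := by
  ext A
  rcases hs with rfl | rfl <;> fin_cases A <;>
    simp [lorentzCross, bivector, omega, wedge, ip4] <;> ring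

lemma lorentzCross_smul_smul (c d : ℝ) (v w : R3) :
    lorentzCross (c • v) (d • w) = (c * d) • lorentzCross v w := by
  ext A
  fin_cases A <;> simp [lorentzCross] <;> ring

/-- The opposite rotations in the two factors are absorbed by the minus sign in the second component
of `normalPoint`, so one formula covers both. -/
lemma complexJ_normalPoint (a b c d : R4) :
    complexJ (normalPoint a b) (normalPoint c d) =
      ip4 a c • normalPoint b d - ip4 a d • normalPoint b c -
        ip4 b c • normalPoint a d + ip4 b d • normalPoint a c := by
  have h : √2 * (1 / √2 * (1 / √2)) = 1 / √2 := by field_simp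
  simp only [complexJ, normalPoint, lorentzCross_smul_smul, smul_smul, neg_mul, h,
    lorentzCross_bivector (Or.inl rfl), lorentzCross_bivector (Or.inr rfl)]
  ext A
  · simp; ring
  · simp; ring

lemma ip3_lorentzCross_self (v w : R3) : ip3 (lorentzCross v w) v = 0 := by
  simp [ip3, lorentzCross]; ring

/-- The vector product with `P` is orthogonal to `P` in each factor, so the normal part of `Z` is
not seen. The covariant derivative of the ambient space may thus be replaced by the flat one. -/
lemma kahlerForm_projGr (P X Z : R33) : kahlerForm P X (projGr P Z) = kahlerForm P X Z := by
  have h1 := ip3_lorentzCross_self P.1 X.1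
  have h2 := ip3_lorentzCross_self P.2 X.2
  simp only [kahlerForm, ip33, complexJ, projGr, projH, ip3, Pi.add_apply, Pi.smul_apply,
    smul_eq_mul] at h1 h2 ⊢
  linear_combination -√2 * (2 * (Z.1 0 * P.1 0 + Z.1 1 * P.1 1 - Z.1 2 * P.1 2)) * h1 +
    √2 * (2 * (Z.2 0 * P.2 0 + Z.2 1 * P.2 1 - Z.2 2 * P.2 2)) * h2

lemma kahlerForm_add_right (P X Y Z : R33) :
    kahlerForm P X (Y + Z) = kahlerForm P X Y + kahlerForm P X Z := by
  simp [kahlerForm, ip33, ip3]; ring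

lemma kahlerForm_sub_right (P X Y Z : R33) :
    kahlerForm P X (Y - Z) = kahlerForm P X Y - kahlerForm P X Z := by
  simp [kahlerForm, ip33, ip3]; ring

lemma kahlerForm_smul_right (c : ℝ) (P X Y : R33) :
    kahlerForm P X (c • Y) = c * kahlerForm P X Y := by
  simp [kahlerForm, ip33, ip3]; ring

lemma kahlerForm_add_left (P X Y Z : R33) :
    kahlerForm P (X + Y) Z = kahlerForm P X Z + kahlerForm P Y Z := by
  simp [kahlerForm, ip33, ip3, complexJ, lorentzCross]; ring

lemma ip33_add_left (X Y Z : R33) : ip33 (X + Y) Z = ip33 X Z + ip33 Y Z := by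
  simp [ip33, ip3]; ring

lemma ip33_add_right (X Y Z : R33) : ip33 X (Y + Z) = ip33 X Y + ip33 X Z := by
  simp [ip33, ip3]; ring

lemma ip33_sub_left (X Y Z : R33) : ip33 (X - Y) Z = ip33 X Z - ip33 Y Z := by
  simp [ip33, ip3]; ring

lemma ip33_smul_left (c : ℝ) (X Y : R33) : ip33 (c • X) Y = c * ip33 X Y := by
  simp [ip33, ip3]; ring

lemma ip3_bivector {s : ℝ} (hs : s = 1 ∨ s = -1) (a b : R4) :
    ip3 (bivector s a b) (bivector s a b) = -(ip4 a a * ip4 b b - ip4 a b ^ 2) := by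
  rcases hs with rfl | rfl <;> simp [ip3, bivector, omega, wedge, ip4] <;> ring

lemma ip3_smul_smul (c d : ℝ) (v w : R3) : ip3 (c • v) (d • w) = c * d * ip3 v w := by
  simp [ip3]; ring

/-- The Gauss image of a future directed normal frame lies in `ℍ × ℍ`. -/
lemma normalPoint_mem_grassmannian {n x : R4} (hn : ip4 n n = -1) (hx : ip4 x x = -1)
    (hnx : ip4 n x = 0) (hT : ip4 n (timeField x) < 0) : normalPoint n x ∈ grassmannian := by
  have hr : 0 < 1 / √2 := by positivity
  have h : 1 / √2 * (1 / √2) = 1 / 2 := by simpa using inv_sqrt_two_sq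
  have h' : -(1 / √2) * -(1 / √2) = 1 / 2 := by rw [neg_mul_neg, h]
  have hT' : 0 < n 2 * x 3 - n 3 * x 2 := by
    simp [ip4, timeField] at hT; linarith
  -- The orthonormality relations express the timelike Gram determinant through spatial components.
  -- Hence `wedge 2 3` dominates `wedge 0 1` and fixes the signs of both third coordinates.
  have hlt : (n 0 * x 1 - n 1 * x 0) ^ 2 < (n 2 * x 3 - n 3 * x 2) ^ 2 := by
    simp only [ip4] at hn hx hnx
    have : (n 2 * x 3 - n 3 * x 2) ^ 2 = 1 + n 0 ^ 2 + n 1 ^ 2 + x 0 ^ 2 + x 1 ^ 2 +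
        (n 0 * x 1 - n 1 * x 0) ^ 2 := by
      linear_combination (-(x 2 * x 2 + x 3 * x 3)) * hn +
        (-(1 + n 0 * n 0 + n 1 * n 1)) * hx +
        (n 0 * x 0 + n 1 * x 1 + n 2 * x 2 + n 3 * x 3) * hnx
    rw [this]; nlinarith [sq_nonneg (n 0), sq_nonneg (n 1), sq_nonneg (x 0), sq_nonneg (x 1)]
  have habs := abs_lt_of_sq_lt_sq' hlt hT'.le
  refine ⟨⟨?_, ?_⟩, ⟨?_, ?_⟩⟩
  · rw [normalPoint, ip3_smul_smul, ip3_bivector (Or.inl rfl), hn, hx, hnx, h]; norm_num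
  · simp only [normalPoint, bivector, omega, wedge, Pi.smul_apply, smul_eq_mul, Matrix.cons_val]
    exact mul_pos hr (by linarith)
  · rw [normalPoint, ip3_smul_smul, ip3_bivector (Or.inr rfl), hn, hx, hnx, h']; norm_num
  · simp only [normalPoint, bivector, omega, wedge, Pi.smul_apply, smul_eq_mul, Matrix.cons_val]
    rw [neg_mul, neg_pos]
    exact mul_neg_of_pos_of_neg hr (by linarith)

/-! ### Partial derivatives -/

section PartialDerivatives

variable {V W Z : Type*} [NormedAddCommGroup V] [NormedSpace ℝ V] [NormedAddCommGroup W]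
  [NormedSpace ℝ W] [NormedAddCommGroup Z] [NormedSpace ℝ Z] {U : Set E2} {x : E2}

lemma eq_sum_basisVec (v : E2) : v = v 0 • basisVec 0 + v 1 • basisVec 1 := by
  ext i; fin_cases i <;> simp [basisVec]

lemma pd_bilin [FiniteDimensional ℝ V] [FiniteDimensional ℝ W] (B : V →ₗ[ℝ] W →ₗ[ℝ] Z)
    {f : E2 → V} {g : E2 → W} (hf : DifferentiableAt ℝ f x) (hg : DifferentiableAt ℝ g x)
    (i : Fin 2) :
    pd (fun y => B (f y) (g y)) i x = B (pd f i x) (g x) + B (f x) (pd g i x) := by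
  have h := ContinuousLinearMap.fderiv_of_bilinear B.toContinuousBilinearMap hf hg
  have h' : (fun y => B (f y) (g y)) = fun y => B.toContinuousBilinearMap (f y) (g y) := rfl
  rw [pd, h', h]
  simp [pd, add_comm]

lemma contDiffAt_bilin [FiniteDimensional ℝ V] [FiniteDimensional ℝ W] (B : V →ₗ[ℝ] W →ₗ[ℝ] Z)
    {f : E2 → V} {g : E2 → W} (hf : ContDiffAt ℝ ∞ f x) (hg : ContDiffAt ℝ ∞ g x) :
    ContDiffAt ℝ ∞ (fun y => B (f y) (g y)) x :=
  (B.toContinuousBilinearMap.contDiff.contDiffAt.comp x hf).clm_apply hg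

lemma contDiffAt_pd {f : E2 → V} (hf : ContDiffAt ℝ ∞ f x) (i : Fin 2) :
    ContDiffAt ℝ ∞ (pd f i) x :=
  (hf.fderiv_right (m := ∞) le_rfl).clm_apply contDiffAt_const

lemma pd_congr (hU : IsOpen U) {f g : E2 → V} (h : ∀ y ∈ U, f y = g y) (hx : x ∈ U)
    (i : Fin 2) : pd f i x = pd g i x := by
  rw [pd, pd, Filter.EventuallyEq.fderiv_eq (Filter.eventually_of_mem (hU.mem_nhds hx) h)]

lemma pd_const (c : V) (i : Fin 2) : pd (fun _ => c) i x = 0 := by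
  simp [pd]

lemma pd_add {f g : E2 → V} (hf : DifferentiableAt ℝ f x) (hg : DifferentiableAt ℝ g x)
    (i : Fin 2) : pd (fun y => f y + g y) i x = pd f i x + pd g i x := by
  rw [pd, fderiv_fun_add hf hg]; rfl

lemma pd_sub {f g : E2 → V} (hf : DifferentiableAt ℝ f x) (hg : DifferentiableAt ℝ g x)
    (i : Fin 2) : pd (fun y => f y - g y) i x = pd f i x - pd g i x := by
  rw [pd, fderiv_fun_sub hf hg]; rfl

lemma pd_mul {f g : E2 → ℝ} (hf : DifferentiableAt ℝ f x) (hg : DifferentiableAt ℝ g x)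
    (i : Fin 2) : pd (fun y => f y * g y) i x = pd f i x * g x + f x * pd g i x := by
  rw [pd, fderiv_fun_mul hf hg]
  simp [pd]; ring

lemma pd_pd_comm {f : E2 → V} (hf : ContDiffAt ℝ ∞ f x) (i j : Fin 2) :
    pd (pd f j) i x = pd (pd f i) j x := by
  have hs : IsSymmSndFDerivAt ℝ f x := hf.isSymmSndFDerivAt (by simpa using WithTop.coe_le_coe.2 (le_top : (2 : ℕ∞) ≤ ⊤))
  have hd : DifferentiableAt ℝ (fderiv ℝ f) x :=
    (hf.fderiv_right (m := ∞) le_rfl).differentiableAt (by simp)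
  have key : ∀ k l, pd (pd f k) l x = fderiv ℝ (fderiv ℝ f) x (basisVec l) (basisVec k) := by
    intro k l
    have : pd f k = fun y => fderiv ℝ f y (basisVec k) := rfl
    rw [pd, this, fderiv_clm_apply hd (differentiableAt_const _)]
    simp
  rw [key, key, hs.eq]

lemma fderiv_eq_pd (f : E2 → V) (v : E2) :
    fderiv ℝ f x v = v 0 • pd f 0 x + v 1 • pd f 1 x := by
  conv_lhs => rw [eq_sum_basisVec v]
  simp [pd]

lemma pd_ip4 {f g : E2 → R4} (hf : DifferentiableAt ℝ f x) (hg : DifferentiableAt ℝ g x)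
    (i : Fin 2) :
    pd (fun y => ip4 (f y) (g y)) i x = ip4 (pd f i x) (g x) + ip4 (f x) (pd g i x) :=
  pd_bilin ip4Bilin hf hg i

end PartialDerivatives

/-! ### Spacelike surfaces in local coordinates -/

/-- A spacelike immersion `f` into `AdS3`, with unit normal `n`, in local coordinates on `U`. -/
structure IsLocalSurface (U : Set E2) (f n : E2 → R4) : Prop where
  isOpen : IsOpen U
  smooth_f : ∀ x ∈ U, ContDiffAt ℝ ∞ f x
  smooth_n : ∀ x ∈ U, ContDiffAt ℝ ∞ n x
  frame : ∀ x ∈ U, IsNormalFrame (pd f 0 x) (pd f 1 x) (n x) (f x)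
  pos : ∀ x ∈ U, 0 < ip4 (pd f 0 x) (pd f 0 x)
  det_pos : ∀ x ∈ U, 0 < ip4 (pd f 0 x) (pd f 0 x) * ip4 (pd f 1 x) (pd f 1 x) -
    ip4 (pd f 0 x) (pd f 1 x) ^ 2

namespace IsLocalSurface

variable {U : Set E2} {f n : E2 → R4} {x : E2} (S : IsLocalSurface U f n) (hx : x ∈ U)
include S hx

lemma diff_f : DifferentiableAt ℝ f x := (S.smooth_f x hx).differentiableAt (by simp)
lemma diff_n : DifferentiableAt ℝ n x := (S.smooth_n x hx).differentiableAt (by simp)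
lemma diff_pd_f (i : Fin 2) : DifferentiableAt ℝ (pd f i) x :=
  (contDiffAt_pd (S.smooth_f x hx) i).differentiableAt (by simp)
lemma diff_pd_n (i : Fin 2) : DifferentiableAt ℝ (pd n i) x :=
  (contDiffAt_pd (S.smooth_n x hx) i).differentiableAt (by simp)

lemma n_pd_f (i : Fin 2) : ip4 (n x) (pd f i x) = 0 := by
  fin_cases i
  exacts [(S.frame x hx).na, (S.frame x hx).nb]

lemma f_pd_f (i : Fin 2) : ip4 (f x) (pd f i x) = 0 := by
  fin_cases i
  exacts [(S.frame x hx).xa, (S.frame x hx).xb]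

lemma pd_n_n (i : Fin 2) : ip4 (pd n i x) (n x) = 0 := by
  have h := pd_ip4 (S.diff_n hx) (S.diff_n hx) i
  rw [pd_congr S.isOpen (g := fun _ => -1) (fun y hy => (S.frame y hy).nn) hx, pd_const] at h
  rw [ip4_comm (n x)] at h
  linarith

lemma pd_n_f (i : Fin 2) : ip4 (pd n i x) (f x) = 0 := by
  have h := pd_ip4 (S.diff_n hx) (S.diff_f hx) i
  rw [pd_congr S.isOpen (g := fun _ => 0) (fun y hy => (S.frame y hy).nx) hx, pd_const] at h
  simp only [S.n_pd_f hx] at h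
  linarith

lemma pd_f_pd_n (i j : Fin 2) :
    ip4 (pd f j x) (pd n i x) = -ip4 (pd (pd f j) i x) (n x) := by
  have h := pd_ip4 (S.diff_n hx) (S.diff_pd_f hx j) i
  rw [pd_congr S.isOpen (g := fun _ => 0) (fun y hy => S.n_pd_f hy j) hx, pd_const] at h
  rw [ip4_comm (pd f j x), ip4_comm _ (n x)]
  linarith

lemma pd_f_pd_n_comm (i j : Fin 2) :
    ip4 (pd f i x) (pd n j x) = ip4 (pd f j x) (pd n i x) := by
  rw [S.pd_f_pd_n hx, S.pd_f_pd_n hx, pd_pd_comm (S.smooth_f x hx)]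

/-- The Weingarten equation. -/
lemma pd_n_eq (i : Fin 2) :
    pd n i x =
      ((ip4 (pd f 1 x) (pd f 1 x) * ip4 (pd f 0 x) (pd n i x) -
        ip4 (pd f 0 x) (pd f 1 x) * ip4 (pd f 1 x) (pd n i x)) /
        (ip4 (pd f 0 x) (pd f 0 x) * ip4 (pd f 1 x) (pd f 1 x) -
          ip4 (pd f 0 x) (pd f 1 x) ^ 2)) • pd f 0 x +
      ((ip4 (pd f 0 x) (pd f 0 x) * ip4 (pd f 1 x) (pd n i x) -
        ip4 (pd f 0 x) (pd f 1 x) * ip4 (pd f 0 x) (pd n i x)) /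
        (ip4 (pd f 0 x) (pd f 0 x) * ip4 (pd f 1 x) (pd f 1 x) -
          ip4 (pd f 0 x) (pd f 1 x) ^ 2)) • pd f 1 x := by
  have hd := (S.det_pos x hx).ne'
  rw [← sub_eq_zero]
  apply (S.frame x hx).eq_zero hd
  · rw [ip4_sub_left, ip4_add_left, ip4_smul_left, ip4_smul_left, ip4_comm (pd n i x),
      ip4_comm (pd f 1 x) (pd f 0 x)]
    generalize hdet : ip4 (pd f 0 x) (pd f 0 x) * ip4 (pd f 1 x) (pd f 1 x) -
      ip4 (pd f 0 x) (pd f 1 x) ^ 2 = d at *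
    field_simp
    rw [← hdet]
    ring
  · rw [ip4_sub_left, ip4_add_left, ip4_smul_left, ip4_smul_left, ip4_comm (pd n i x)]
    generalize hdet : ip4 (pd f 0 x) (pd f 0 x) * ip4 (pd f 1 x) (pd f 1 x) -
      ip4 (pd f 0 x) (pd f 1 x) ^ 2 = d at *
    field_simp
    rw [← hdet]
    ring
  · rw [ip4_sub_left, ip4_add_left, ip4_smul_left, ip4_smul_left, (S.frame x hx).an,
      (S.frame x hx).bn, S.pd_n_n hx]
    ring
  · rw [ip4_sub_left, ip4_add_left, ip4_smul_left, ip4_smul_left, (S.frame x hx).ax,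
      (S.frame x hx).bx, S.pd_n_f hx]
    ring

lemma pd_normalPoint (i : Fin 2) :
    pd (fun y => normalPoint (n y) (f y)) i x =
      normalPoint (pd n i x) (f x) + normalPoint (n x) (pd f i x) :=
  pd_bilin normalPointBilin (S.diff_n hx) (S.diff_f hx) i

lemma pd_pd_normalPoint (j k : Fin 2) :
    pd (pd (fun y => normalPoint (n y) (f y)) k) j x =
      normalPoint (pd (pd n k) j x) (f x) + normalPoint (pd n k x) (pd f j x) +
        (normalPoint (pd n j x) (pd f k x) + normalPoint (n x) (pd (pd f k) j x)) := by
  rw [pd_congr S.isOpen (fun y hy => S.pd_normalPoint hy k) hx,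
    pd_add (f := fun y => normalPoint (pd n k y) (f y)) (g := fun y => normalPoint (n y) (pd f k y))
    ((contDiffAt_bilin normalPointBilin (contDiffAt_pd (S.smooth_n x hx) k)
      (S.smooth_f x hx)).differentiableAt (by simp))
    ((contDiffAt_bilin normalPointBilin (S.smooth_n x hx)
      (contDiffAt_pd (S.smooth_f x hx) k)).differentiableAt (by simp))]
  exact congrArg₂ _ (pd_bilin normalPointBilin (S.diff_pd_n hx k) (S.diff_f hx) j)
    (pd_bilin normalPointBilin (S.diff_n hx) (S.diff_pd_f hx k) j)

lemma ip33_pd_normalPoint (i j : Fin 2) :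
    ip33 (pd (fun y => normalPoint (n y) (f y)) i x) (pd (fun y => normalPoint (n y) (f y)) j x) =
      ip4 (pd f i x) (pd f j x) + ip4 (pd n i x) (pd n j x) := by
  rw [S.pd_normalPoint hx, S.pd_normalPoint hx]
  simp only [ip33_add_left, ip33_add_right, ip33_normalPoint, (S.frame x hx).nn,
    (S.frame x hx).xx, (S.frame x hx).nx, (S.frame x hx).xn, S.pd_n_f hx, S.pd_n_n hx,
    S.n_pd_f hx, S.f_pd_f hx, ip4_comm (n x) (pd n _ x), ip4_comm (f x) (pd n _ x),
    ip4_comm (pd f _ x) (f x), ip4_comm (pd f _ x) (n x)]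
  ring

lemma complexJ_pd_normalPoint (i : Fin 2) :
    complexJ (normalPoint (n x) (f x)) (pd (fun y => normalPoint (n y) (f y)) i x) =
      normalPoint (pd f i x) (f x) - normalPoint (n x) (pd n i x) := by
  have hadd : ∀ P X Y : R33, complexJ P (X + Y) = complexJ P X + complexJ P Y := by
    intro P X Y
    ext A <;> fin_cases A <;> simp [complexJ, lorentzCross] <;> ring
  rw [S.pd_normalPoint hx, hadd]
  simp only [complexJ_normalPoint, (S.frame x hx).nn,
    (S.frame x hx).xx, (S.frame x hx).nx, (S.frame x hx).xn,
    S.n_pd_f hx, S.f_pd_f hx, ip4_comm (n x) (pd n _ x), ip4_comm (f x) (pd n _ x),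
    S.pd_n_f hx, S.pd_n_n hx]
  rw [normalPoint_swap (f x) (pd f i x)]
  simp only [zero_smul, neg_smul, one_smul]
  abel

lemma kahlerForm_pd_normalPoint (i j : Fin 2) :
    kahlerForm (normalPoint (n x) (f x)) (pd (fun y => normalPoint (n y) (f y)) i x)
      (pd (fun y => normalPoint (n y) (f y)) j x) = 0 := by
  rw [kahlerForm, S.complexJ_pd_normalPoint hx, S.pd_normalPoint hx]
  simp only [ip33_sub_left, ip33_add_right, ip33_normalPoint, (S.frame x hx).nn,
    (S.frame x hx).xx, (S.frame x hx).nx, (S.frame x hx).xn, S.pd_n_f hx, S.pd_n_n hx,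
    S.n_pd_f hx, S.f_pd_f hx, ip4_comm (n x) (pd n _ x), ip4_comm (f x) (pd n _ x),
    ip4_comm (pd f _ x) (f x), ip4_comm (pd f _ x) (n x), ip4_comm (pd n _ x) (pd f _ x)]
  rw [S.pd_f_pd_n_comm hx i j]
  ring

lemma kahlerForm_pd_pd_normalPoint (i j k : Fin 2) :
    kahlerForm (normalPoint (n x) (f x)) (pd (fun y => normalPoint (n y) (f y)) i x)
      (pd (pd (fun y => normalPoint (n y) (f y)) k) j x) =
      ip4 (pd f i x) (pd (pd n k) j x) - ip4 (pd (pd f k) j x) (pd n i x) := by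
  rw [kahlerForm, S.complexJ_pd_normalPoint hx, S.pd_pd_normalPoint hx]
  simp only [ip33_sub_left, ip33_add_right, ip33_normalPoint, (S.frame x hx).nn,
    (S.frame x hx).xx, (S.frame x hx).nx, (S.frame x hx).xn, S.pd_n_f hx, S.pd_n_n hx,
    S.n_pd_f hx, S.f_pd_f hx, ip4_comm (n x) (pd n _ x), ip4_comm (f x) (pd n _ x),
    ip4_comm (pd f _ x) (f x), ip4_comm (pd f _ x) (n x)]
  rw [ip4_comm (pd n i x) (pd (pd f k) j x)]
  ring

/-- The Codazzi equation, as the symmetry of the second fundamental tensor of the Gauss map. -/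
lemma codazzi (i j k : Fin 2) :
    ip4 (pd f i x) (pd (pd n k) j x) - ip4 (pd (pd f k) j x) (pd n i x) =
      ip4 (pd f j x) (pd (pd n k) i x) - ip4 (pd (pd f k) i x) (pd n j x) := by
  -- The ambient space is flat, so differentiating the symmetry of the second fundamental form along
  -- `∂ₖ` and commuting partial derivatives is enough.
  have h1 := pd_ip4 (S.diff_pd_f hx i) (S.diff_pd_n hx j) k
  have h2 := pd_ip4 (S.diff_pd_f hx j) (S.diff_pd_n hx i) k
  rw [pd_congr S.isOpen (fun y hy => S.pd_f_pd_n_comm hy i j) hx, h2] at h1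
  rw [pd_pd_comm (S.smooth_f x hx) k i, pd_pd_comm (S.smooth_f x hx) k j,
    pd_pd_comm (S.smooth_n x hx) k i, pd_pd_comm (S.smooth_n x hx) k j] at h1
  linarith

end IsLocalSurface

/-! ### The Lagrangian angle of a pair of quadratic forms -/

/-- The complex number `det g - det h + i det g tr (g⁻¹ h)`. It is a positive multiple of
`(1 + i λ₁) (1 + i λ₂)`, where `λ₁, λ₂` are the eigenvalues of `g⁻¹ h`. -/
def angleNumber (g h : Matrix (Fin 2) (Fin 2) ℝ) : ℂ :=
  ⟨g.det - h.det, g 0 0 * h 1 1 - g 0 1 * h 1 0 - g 1 0 * h 0 1 + g 1 1 * h 0 0⟩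

/-- `angleNumber g h` is `det (g + ih)`, and `(det C)²` is positive for invertible `C`. This makes
the argument independent of the chart. -/
lemma angleNumber_congruence (g h C : Matrix (Fin 2) (Fin 2) ℝ) :
    angleNumber (C.transpose * g * C) (C.transpose * h * C) =
      ((C.det ^ 2 : ℝ) : ℂ) * angleNumber g h := by
  apply Complex.ext
  · simp only [angleNumber, Complex.re_ofReal_mul, Matrix.det_mul, Matrix.det_transpose]
    ring
  · simp only [angleNumber, Complex.im_ofReal_mul, Matrix.det_fin_two, Matrix.mul_apply,
      Matrix.transpose_apply, Fin.sum_univ_two]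
    ring

lemma arg_one_add_mul_I (t : ℝ) : Complex.arg (1 + t * Complex.I) = Real.arctan t := by
  rw [Complex.arg_of_re_nonneg (by simp)]
  rw [Real.arctan_eq_arcsin]
  congr 1
  simp [Complex.norm_def, Complex.normSq_apply, sq]

lemma one_add_mul_one_add_mem_slitPlane (s t : ℝ) :
    (1 + s * Complex.I) * (1 + t * Complex.I) ∈ Complex.slitPlane := by
  rw [Complex.mem_slitPlane_iff]
  simp
  by_cases h : t + s = 0
  -- If the imaginary part vanishes, the real part is `1 - ts = 1 + s²`, which is positive.
  · left
    have : t = -s := by linarith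
    subst this
    nlinarith [sq_nonneg s]
  · exact Or.inr h

/-- Each factor has its argument in `(-π/2, π/2)`, so the arguments add without a correction by
`2π`. -/
lemma arctan_add_arctan_eq_arg (s t : ℝ) :
    Real.arctan s + Real.arctan t =
      Complex.arg ((1 + s * Complex.I) * (1 + t * Complex.I)) := by
  have hne : ∀ r : ℝ, (1 + r * Complex.I : ℂ) ≠ 0 := by
    intro r h
    have := congrArg Complex.re h
    simp at this
  rw [Complex.arg_mul (hne s) (hne t), arg_one_add_mul_I, arg_one_add_mul_I]
  rw [arg_one_add_mul_I, arg_one_add_mul_I]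
  constructor
  · linarith [Real.neg_pi_div_two_lt_arctan s, Real.neg_pi_div_two_lt_arctan t]
  · linarith [Real.arctan_lt_pi_div_two s, Real.arctan_lt_pi_div_two t]

/-- In a `g`-orthonormal basis that starts along the first coordinate vector, the discriminant is
`(h₁₁ - h₂₂)² + 4 h₁₂²`. The sum of squares in the proof is this expression with denominators
cleared. -/
lemma discriminant_nonneg {a b c p q r : ℝ} (ha : 0 < a) (hd : 0 < a * c - b ^ 2) :
    4 * (a * c - b ^ 2) * (p * r - q ^ 2) ≤ (a * r - 2 * b * q + c * p) ^ 2 := by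
  have key : a ^ 2 * ((a * r - 2 * b * q + c * p) ^ 2 - 4 * (a * c - b ^ 2) * (p * r - q ^ 2)) =
      (a * (a * r - c * p) - 2 * b * (a * q - b * p)) ^ 2 +
        4 * (a * c - b ^ 2) * (a * q - b * p) ^ 2 := by
    ring
  have h : 0 ≤ a ^ 2 * ((a * r - 2 * b * q + c * p) ^ 2 -
      4 * (a * c - b ^ 2) * (p * r - q ^ 2)) := by
    rw [key]; positivity
  have := nonneg_of_mul_nonneg_right h (by positivity)
  linarith

/-- The eigenvalues of `g⁻¹ h` are real, and the sum of their arcus tangents is the argument of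
`angleNumber g h`. -/
lemma exists_eigenvalues {g h : Matrix (Fin 2) (Fin 2) ℝ} (hg : g 1 0 = g 0 1)
    (hh : h 1 0 = h 0 1) (hpos : 0 < g 0 0) (hdet : 0 < g.det) :
    ∃ l m : ℝ, l ≤ m ∧ (g⁻¹ * h).charpoly.roots = {l, m} ∧
      angleNumber g h ∈ Complex.slitPlane ∧
      Real.arctan l + Real.arctan m = Complex.arg (angleNumber g h) := by
  have hd' : g.det = g 0 0 * g 1 1 - g 0 1 ^ 2 := by rw [Matrix.det_fin_two, hg]; ring
  have hk' : h.det = h 0 0 * h 1 1 - h 0 1 ^ 2 := by rw [Matrix.det_fin_two, hh]; ring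
  set H := (angleNumber g h).im / g.det with hH
  have him : (angleNumber g h).im = g 0 0 * h 1 1 - 2 * g 0 1 * h 0 1 + g 1 1 * h 0 0 := by
    simp only [angleNumber, hg, hh]; ring
  set K := h.det / g.det with hK
  have htr : (g⁻¹ * h).trace = H := by
    rw [hH, him, Matrix.inv_def, Matrix.adjugate_fin_two, Matrix.trace_fin_two]
    simp [Matrix.mul_apply, Fin.sum_univ_two, hg, hh]
    field_simp
    ring
  have hdt : (g⁻¹ * h).det = K := by
    rw [Matrix.det_mul, Matrix.det_nonsing_inv, Ring.inverse_eq_inv', hK]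
    field_simp
  have hdisc : 0 ≤ H ^ 2 - 4 * K := by
    have := discriminant_nonneg (p := h 0 0) (q := h 0 1) (r := h 1 1) hpos (hd' ▸ hdet)
    rw [← hd', ← hk', ← him] at this
    rw [hH, hK, div_pow, show (angleNumber g h).im ^ 2 / g.det ^ 2 - 4 * (h.det / g.det) =
      ((angleNumber g h).im ^ 2 - 4 * g.det * h.det) / g.det ^ 2 by field_simp]
    exact div_nonneg (by linarith) (by positivity)
  have hsq := Real.sq_sqrt hdisc
  set q := √(H ^ 2 - 4 * K)
  have hq : 0 ≤ q := Real.sqrt_nonneg _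
  -- The roots `(H ± q)/2` have sum `H = tr (g⁻¹h)` and product `K = det (g⁻¹h)`.
  have hang : angleNumber g h = ((g.det : ℝ) : ℂ) *
      ((1 + ((H - q) / 2 : ℝ) * Complex.I) * (1 + ((H + q) / 2 : ℝ) * Complex.I)) := by
    apply Complex.ext
    · rw [Complex.re_ofReal_mul]
      simp [angleNumber]
      have : (H - q) / 2 * ((H + q) / 2) = K := by linear_combination -hsq / 4
      rw [this, hK]
      field_simp
    · rw [Complex.im_ofReal_mul]
      simp
      have : (H + q) / 2 + (H - q) / 2 = H := by ring
      rw [this, hH]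
      field_simp
  refine ⟨(H - q) / 2, (H + q) / 2, by linarith, ?_, ?_, ?_⟩
  · have : (g⁻¹ * h).charpoly =
        (Polynomial.X - Polynomial.C ((H - q) / 2)) *
          (Polynomial.X - Polynomial.C ((H + q) / 2)) := by
      rw [Matrix.charpoly_fin_two, htr, hdt]
      have e1 : H = (H - q) / 2 + (H + q) / 2 := by ring
      have e2 : K = (H - q) / 2 * ((H + q) / 2) := by linear_combination hsq / 4
      generalize (H - q) / 2 = l at e1 e2 ⊢
      generalize (H + q) / 2 = m at e1 e2 ⊢
      rw [e1, e2]
      simp only [map_add, map_mul]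
      ring
    rw [this, Polynomial.roots_mul (mul_ne_zero (Polynomial.X_sub_C_ne_zero _)
      (Polynomial.X_sub_C_ne_zero _)), Polynomial.roots_X_sub_C, Polynomial.roots_X_sub_C]
    rfl
  · rw [hang, Complex.mem_slitPlane_iff_arg, Complex.arg_real_mul _ hdet]
    have hs := one_add_mul_one_add_mem_slitPlane ((H - q) / 2) ((H + q) / 2)
    rw [Complex.mem_slitPlane_iff_arg] at hs
    exact ⟨hs.1, mul_ne_zero (by exact_mod_cast hdet.ne') hs.2⟩
  · rw [hang, Complex.arg_real_mul _ hdet, arctan_add_arctan_eq_arg]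

/-! ### The derivative of the argument -/

lemma contDiffAt_arg {z : ℂ} (hz : z ∈ Complex.slitPlane) : ContDiffAt ℝ ∞ Complex.arg z := by
  have h : ContDiffAt ℝ ∞ Complex.log z := (Complex.contDiffAt_log hz).restrict_scalars ℝ
  have h2 := Complex.imCLM.contDiff.contDiffAt.comp z h
  have : Complex.arg = Complex.imCLM ∘ Complex.log := by
    funext w; simp [Complex.log_im]
  rw [this]; exact h2

lemma pd_arg {z : E2 → ℂ} {x : E2} (hz : DifferentiableAt ℝ z x)
    (hx : z x ∈ Complex.slitPlane) (i : Fin 2) :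
    pd (fun y => Complex.arg (z y)) i x =
      ((z x).re * (pd z i x).im - (z x).im * (pd z i x).re) /
        ((z x).re ^ 2 + (z x).im ^ 2) := by
  have h1 := (Complex.hasStrictFDerivAt_log_real hx).hasFDerivAt.comp x hz.hasFDerivAt
  have h2 := Complex.imCLM.hasFDerivAt.comp x h1
  have h3 : (fun y => Complex.arg (z y)) = Complex.imCLM ∘ Complex.log ∘ z := by
    funext w; simp [Complex.log_im]
  rw [pd, h3, h2.fderiv]
  simp [pd, Complex.normSq_apply]
  ring

/-- The trace identity behind the formula for the mean curvature form. Here `q` are the components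
of the derivative of the first fundamental form `g`, and `k` the derivative of the second
fundamental form `h`, whose Weingarten map is `w`. -/
lemma trace_identity {a b c p q r : ℝ} (hpos : 0 < a) (hd : 0 < a * c - b ^ 2)
    (Q w : Fin 2 → Fin 2 → ℝ) (k₀ k₁ k₂ : ℝ)
    (hw00 : w 0 0 = (c * p - b * q) / (a * c - b ^ 2))
    (hw01 : w 0 1 = (c * q - b * r) / (a * c - b ^ 2))
    (hw10 : w 1 0 = (a * q - b * p) / (a * c - b ^ 2))
    (hw11 : w 1 1 = (a * r - b * q) / (a * c - b ^ 2))
    (σ τ : Matrix (Fin 2) (Fin 2) ℝ)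
    (hσ00 : σ 0 0 = a + (w 0 0 * p + w 1 0 * q)) (hσ01 : σ 0 1 = b + (w 0 1 * p + w 1 1 * q))
    (hσ10 : σ 1 0 = b + (w 0 0 * q + w 1 0 * r)) (hσ11 : σ 1 1 = c + (w 0 1 * q + w 1 1 * r))
    (hτ00 : τ 0 0 = k₀ - 2 * (w 0 0 * Q 0 0 + w 1 0 * Q 0 1))
    (hτ01 : τ 0 1 = k₁ - (w 0 1 * Q 0 0 + w 1 1 * Q 0 1) - (w 0 0 * Q 1 0 + w 1 0 * Q 1 1))
    (hτ10 : τ 1 0 = k₁ - (w 0 1 * Q 0 0 + w 1 1 * Q 0 1) - (w 0 0 * Q 1 0 + w 1 0 * Q 1 1))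
    (hτ11 : τ 1 1 = k₂ - 2 * (w 0 1 * Q 1 0 + w 1 1 * Q 1 1)) :
    ∑ i, ∑ j, σ⁻¹ i j * τ i j =
      (((a * c - b ^ 2) - (p * r - q ^ 2)) *
          (2 * Q 0 0 * r + a * k₂ - 2 * ((Q 0 1 + Q 1 0) * q + b * k₁) + 2 * Q 1 1 * p + c * k₀) -
        (a * r - 2 * b * q + c * p) *
          (2 * Q 0 0 * c + 2 * Q 1 1 * a - 2 * b * (Q 0 1 + Q 1 0) -
            (k₀ * r + p * k₂ - 2 * q * k₁))) /
      (((a * c - b ^ 2) - (p * r - q ^ 2)) ^ 2 + (a * r - 2 * b * q + c * p) ^ 2) := by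
  have hN : 0 < ((a * c - b ^ 2) - (p * r - q ^ 2)) ^ 2 + (a * r - 2 * b * q + c * p) ^ 2 := by
    have h1 := discriminant_nonneg (p := p) (q := q) (r := r) hpos hd
    generalize a * c - b ^ 2 = d at *
    generalize p * r - q ^ 2 = k at *
    generalize a * r - 2 * b * q + c * p = S at *
    -- If both squares vanished, then `k = d` and `S = 0`, and the discriminant inequality would
    -- give `4d² ≤ 0`.
    by_contra hcon
    have h2 : (d - k) ^ 2 = 0 := by nlinarith [sq_nonneg (d - k), sq_nonneg S]
    have h3 : S ^ 2 = 0 := by nlinarith [sq_nonneg (d - k), sq_nonneg S]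
    have h4 : d = k := by have := pow_eq_zero_iff (two_ne_zero) |>.1 h2; linarith
    nlinarith
  set d := a * c - b ^ 2 with hdd
  set D := d - (p * r - q ^ 2) with hD
  set S := a * r - 2 * b * q + c * p with hS
  -- By Cayley–Hamilton, `W² = (tr W) W - det W`, so `σ = g + hW` is the combination `(D g + S h) /
  -- d`.
  have hs00 : σ 0 0 = (D * a + S * p) / d := by
    rw [hσ00, hw00, hw10]; field_simp; rw [hD, hS, hdd]; ring
  have hs01 : σ 0 1 = (D * b + S * q) / d := by
    rw [hσ01, hw01, hw11]; field_simp; rw [hD, hS, hdd]; ring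
  have hs10 : σ 1 0 = (D * b + S * q) / d := by
    rw [hσ10, hw00, hw10]; field_simp; rw [hD, hS, hdd]; ring
  have hs11 : σ 1 1 = (D * c + S * r) / d := by
    rw [hσ11, hw01, hw11]; field_simp; rw [hD, hS, hdd]; ring
  -- This is `|det (g + ih)|² / det g`, which explains the denominator of the derivative of the
  -- argument.
  have hdet : σ.det = (D ^ 2 + S ^ 2) / d := by
    rw [Matrix.det_fin_two, hs00, hs01, hs10, hs11]; field_simp; rw [hD, hS, hdd]; ring
  simp only [Fin.sum_univ_two, Matrix.inv_def, Matrix.adjugate_fin_two, Ring.inverse_eq_inv',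
    Matrix.smul_apply, smul_eq_mul, Matrix.of_apply, Matrix.cons_val]
  rw [hdet, hτ00, hτ01, hτ10, hτ11, hs00, hs01, hs10, hs11, hw00, hw01, hw10, hw11]
  field_simp
  rw [hD, hS, hdd]
  ring

/-! ### The mean curvature form of the Gauss map in coordinates -/

lemma pd_re {z : E2 → ℂ} {x : E2} (hz : DifferentiableAt ℝ z x) (i : Fin 2) :
    pd (fun y => (z y).re) i x = (pd z i x).re := by
  have h := Complex.reCLM.hasFDerivAt.comp x hz.hasFDerivAt
  have h' : (fun y => (z y).re) = Complex.reCLM ∘ z := rfl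
  rw [pd, h', h.fderiv]; rfl

lemma pd_im {z : E2 → ℂ} {x : E2} (hz : DifferentiableAt ℝ z x) (i : Fin 2) :
    pd (fun y => (z y).im) i x = (pd z i x).im := by
  have h := Complex.imCLM.hasFDerivAt.comp x hz.hasFDerivAt
  have h' : (fun y => (z y).im) = Complex.imCLM ∘ z := rfl
  rw [pd, h', h.fderiv]; rfl

/-- The pairing `⟨∂ᵢ f, ∂ⱼ n⟩`, which is the second fundamental form if `n` is the unit normal. -/
def secondForm (f n : E2 → R4) (x : E2) : Matrix (Fin 2) (Fin 2) ℝ :=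
  Matrix.of fun i j => ip4 (pd f i x) (pd n j x)

/-- The complex number whose argument is the Lagrangian angle. -/
def localAngleNumber (f n : E2 → R4) (x : E2) : ℂ :=
  angleNumber (inducedMetric ip4 f x) (secondForm f n x)

namespace IsLocalSurface

variable {U : Set E2} {f n : E2 → R4} {x : E2} (S : IsLocalSurface U f n) (hx : x ∈ U)
include S hx

lemma det_inducedMetric_pos : 0 < (inducedMetric ip4 f x).det := by
  have := S.det_pos x hx
  simp only [inducedMetric, Matrix.det_fin_two, Matrix.of_apply]
  rw [ip4_comm (pd f 1 x) (pd f 0 x)]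
  linarith

lemma localAngleNumber_mem_slitPlane : localAngleNumber f n x ∈ Complex.slitPlane := by
  obtain ⟨-, -, -, -, h, -⟩ := exists_eigenvalues (g := inducedMetric ip4 f x)
    (h := secondForm f n x) (ip4_comm _ _) (S.pd_f_pd_n_comm hx 1 0) (S.pos x hx)
    (S.det_inducedMetric_pos hx)
  exact h

lemma contDiffAt_localAngleNumber : ContDiffAt ℝ ∞ (localAngleNumber f n) x := by
  have hf := fun i => contDiffAt_pd (S.smooth_f x hx) i
  have hn := fun i => contDiffAt_pd (S.smooth_n x hx) i
  have hg : ∀ i j, ContDiffAt ℝ ∞ (fun y => ip4 (pd f i y) (pd f j y)) x :=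
    fun i j => contDiffAt_bilin ip4Bilin (hf i) (hf j)
  have hh : ∀ i j, ContDiffAt ℝ ∞ (fun y => ip4 (pd f i y) (pd n j y)) x :=
    fun i j => contDiffAt_bilin ip4Bilin (hf i) (hn j)
  have h1 : ContDiffAt ℝ ∞ (fun y => (localAngleNumber f n y).re) x := by
    simp only [localAngleNumber, angleNumber, Matrix.det_fin_two, inducedMetric, secondForm,
      Matrix.of_apply]
    exact (((hg 0 0).mul (hg 1 1)).sub ((hg 0 1).mul (hg 1 0))).sub
      (((hh 0 0).mul (hh 1 1)).sub ((hh 0 1).mul (hh 1 0)))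
  have h2 : ContDiffAt ℝ ∞ (fun y => (localAngleNumber f n y).im) x := by
    simp only [localAngleNumber, angleNumber, inducedMetric, secondForm, Matrix.of_apply]
    exact ((((hg 0 0).mul (hh 1 1)).sub ((hg 0 1).mul (hh 1 0))).sub
      ((hg 1 0).mul (hh 0 1))).add ((hg 1 1).mul (hh 0 0))
  have h3 : localAngleNumber f n =
      fun y => Complex.equivRealProdCLM.symm ((localAngleNumber f n y).re,
        (localAngleNumber f n y).im) := by
    funext y
    exact (Complex.equivRealProdCLM.symm_apply_apply (localAngleNumber f n y)).symm
  rw [h3]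
  exact Complex.equivRealProdCLM.symm.contDiff.contDiffAt.comp x (h1.prodMk h2)

lemma pd_metric (i j k : Fin 2) : pd (fun y => ip4 (pd f j y) (pd f k y)) i x =
    ip4 (pd (pd f j) i x) (pd f k x) + ip4 (pd (pd f k) i x) (pd f j x) := by
  rw [pd_ip4 (S.diff_pd_f hx j) (S.diff_pd_f hx k), ip4_comm (pd f j x)]

/-- The coefficients `Γ` can be arbitrary, since the Lagrangian condition annihilates every
tangential correction. The Codazzi equation moves the derivative to direction `i`; the right-hand
side is `∇ᵢhⱼₖ` for the connection of `g`, because `∂ₖn` is tangential. -/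
lemma kahlerForm_lagHessian_expr (Γ : Fin 2 → Fin 2 → Fin 2 → ℝ) (i j k : Fin 2) :
    kahlerForm (normalPoint (n x) (f x)) (pd (fun y => normalPoint (n y) (f y)) i x)
      (projGr (normalPoint (n x) (f x)) (pd (pd (fun y => normalPoint (n y) (f y)) k) j x) -
        ∑ l, Γ l j k • pd (fun y => normalPoint (n y) (f y)) l x) =
      pd (fun y => ip4 (pd f j y) (pd n k y)) i x - ip4 (pd (pd f j) i x) (pd n k x) -
        ip4 (pd (pd f k) i x) (pd n j x) := by
  rw [kahlerForm_sub_right, kahlerForm_projGr, Fin.sum_univ_two, kahlerForm_add_right,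
    kahlerForm_smul_right, kahlerForm_smul_right, S.kahlerForm_pd_normalPoint hx,
    S.kahlerForm_pd_normalPoint hx, S.kahlerForm_pd_pd_normalPoint hx, S.codazzi hx,
    pd_ip4 (S.diff_pd_f hx j) (S.diff_pd_n hx k)]
  ring

/-- The mean curvature form of the Gauss map in local coordinates. -/
lemma meanCurvature_eq_pd_arg (Γ : Fin 2 → Fin 2 → Fin 2 → ℝ) (i : Fin 2) :
    ∑ j, ∑ k, (inducedMetric ip33 (fun y => normalPoint (n y) (f y)) x)⁻¹ j k *
      kahlerForm (normalPoint (n x) (f x)) (pd (fun y => normalPoint (n y) (f y)) i x)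
      (projGr (normalPoint (n x) (f x)) (pd (pd (fun y => normalPoint (n y) (f y)) k) j x) -
        ∑ l, Γ l j k • pd (fun y => normalPoint (n y) (f y)) l x) =
    pd (fun y => Complex.arg (localAngleNumber f n y)) i x := by
  have hz := (S.contDiffAt_localAngleNumber hx).differentiableAt (by simp)
  have hdg : ∀ j k, DifferentiableAt ℝ (fun y => ip4 (pd f j y) (pd f k y)) x := fun j k =>
    (contDiffAt_bilin ip4Bilin (contDiffAt_pd (S.smooth_f x hx) j)
      (contDiffAt_pd (S.smooth_f x hx) k)).differentiableAt (by simp)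
  have hdh : ∀ j k, DifferentiableAt ℝ (fun y => ip4 (pd f j y) (pd n k y)) x := fun j k =>
    (contDiffAt_bilin ip4Bilin (contDiffAt_pd (S.smooth_f x hx) j)
      (contDiffAt_pd (S.smooth_n x hx) k)).differentiableAt (by simp)
  have hre : ∀ y ∈ U, (localAngleNumber f n y).re =
      (ip4 (pd f 0 y) (pd f 0 y) * ip4 (pd f 1 y) (pd f 1 y) -
        ip4 (pd f 0 y) (pd f 1 y) * ip4 (pd f 0 y) (pd f 1 y)) -
      (ip4 (pd f 0 y) (pd n 0 y) * ip4 (pd f 1 y) (pd n 1 y) -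
        ip4 (pd f 0 y) (pd n 1 y) * ip4 (pd f 0 y) (pd n 1 y)) := by
    intro y hy
    simp only [localAngleNumber, angleNumber, Matrix.det_fin_two, inducedMetric, secondForm,
      Matrix.of_apply]
    rw [ip4_comm (pd f 1 y) (pd f 0 y), S.pd_f_pd_n_comm hy 1 0]
  have him : ∀ y ∈ U, (localAngleNumber f n y).im =
      (ip4 (pd f 0 y) (pd f 0 y) * ip4 (pd f 1 y) (pd n 1 y) +
        ip4 (pd f 1 y) (pd f 1 y) * ip4 (pd f 0 y) (pd n 0 y)) -
      (ip4 (pd f 0 y) (pd f 1 y) * ip4 (pd f 0 y) (pd n 1 y) +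
        ip4 (pd f 0 y) (pd f 1 y) * ip4 (pd f 0 y) (pd n 1 y)) := by
    intro y hy
    simp only [localAngleNumber, angleNumber, inducedMetric, secondForm, Matrix.of_apply]
    rw [ip4_comm (pd f 1 y) (pd f 0 y), S.pd_f_pd_n_comm hy 1 0]
    ring
  have hpre := pd_re hz i
  rw [pd_congr S.isOpen hre hx, pd_sub (((hdg 0 0).fun_mul (hdg 1 1)).fun_sub ((hdg 0 1).fun_mul (hdg 0 1)))
    (((hdh 0 0).fun_mul (hdh 1 1)).fun_sub ((hdh 0 1).fun_mul (hdh 0 1))),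
    pd_sub ((hdg 0 0).fun_mul (hdg 1 1)) ((hdg 0 1).fun_mul (hdg 0 1)),
    pd_sub ((hdh 0 0).fun_mul (hdh 1 1)) ((hdh 0 1).fun_mul (hdh 0 1)),
    pd_mul (hdg 0 0) (hdg 1 1), pd_mul (hdg 0 1) (hdg 0 1), pd_mul (hdh 0 0) (hdh 1 1),
    pd_mul (hdh 0 1) (hdh 0 1), S.pd_metric hx, S.pd_metric hx, S.pd_metric hx] at hpre
  have hpim := pd_im hz i
  rw [pd_congr S.isOpen him hx, pd_sub (((hdg 0 0).fun_mul (hdh 1 1)).fun_add ((hdg 1 1).fun_mul (hdh 0 0)))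
    (((hdg 0 1).fun_mul (hdh 0 1)).fun_add ((hdg 0 1).fun_mul (hdh 0 1))),
    pd_add ((hdg 0 0).fun_mul (hdh 1 1)) ((hdg 1 1).fun_mul (hdh 0 0)),
    pd_add ((hdg 0 1).fun_mul (hdh 0 1)) ((hdg 0 1).fun_mul (hdh 0 1)),
    pd_mul (hdg 0 0) (hdh 1 1), pd_mul (hdg 1 1) (hdh 0 0), pd_mul (hdg 0 1) (hdh 0 1),
    S.pd_metric hx, S.pd_metric hx, S.pd_metric hx] at hpim
  rw [pd_arg hz (S.localAngleNumber_mem_slitPlane hx), ← hpre, ← hpim, hre x hx, him x hx]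
  have hpos := S.pos x hx
  have hdet := S.det_pos x hx
  -- `w` holds the Weingarten coefficients: `∂ₖn = w 0 k ∂₀f + w 1 k ∂₁f`.
  obtain ⟨w, hw⟩ : ∃ w : Fin 2 → Fin 2 → ℝ, w = fun l k =>
      ![(ip4 (pd f 1 x) (pd f 1 x) * ip4 (pd f 0 x) (pd n k x) -
        ip4 (pd f 0 x) (pd f 1 x) * ip4 (pd f 1 x) (pd n k x)) /
        (ip4 (pd f 0 x) (pd f 0 x) * ip4 (pd f 1 x) (pd f 1 x) -
          ip4 (pd f 0 x) (pd f 1 x) ^ 2),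
        (ip4 (pd f 0 x) (pd f 0 x) * ip4 (pd f 1 x) (pd n k x) -
        ip4 (pd f 0 x) (pd f 1 x) * ip4 (pd f 0 x) (pd n k x)) /
        (ip4 (pd f 0 x) (pd f 0 x) * ip4 (pd f 1 x) (pd f 1 x) -
          ip4 (pd f 0 x) (pd f 1 x) ^ 2)] l := ⟨_, rfl⟩
  have hpn : ∀ v k, ip4 v (pd n k x) = w 0 k * ip4 v (pd f 0 x) + w 1 k * ip4 v (pd f 1 x) := by
    intro v k
    conv_lhs => rw [S.pd_n_eq hx k]
    rw [ip4_add_right, ip4_smul_right, ip4_smul_right, hw]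
    rfl
  have h10 := S.pd_f_pd_n_comm hx 1 0
  have hk10 := pd_congr S.isOpen (fun y hy => S.pd_f_pd_n_comm hy 1 0) hx i
  have key := trace_identity (p := ip4 (pd f 0 x) (pd n 0 x)) (q := ip4 (pd f 0 x) (pd n 1 x))
    (r := ip4 (pd f 1 x) (pd n 1 x)) hpos hdet
    (fun j l => ip4 (pd (pd f j) i x) (pd f l x)) w
    (pd (fun y => ip4 (pd f 0 y) (pd n 0 y)) i x) (pd (fun y => ip4 (pd f 0 y) (pd n 1 y)) i x)
    (pd (fun y => ip4 (pd f 1 y) (pd n 1 y)) i x)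
    (by rw [hw]; simp [h10]) (by rw [hw]; simp) (by rw [hw]; simp [h10]) (by rw [hw]; simp)
    (inducedMetric ip33 (fun y => normalPoint (n y) (f y)) x)
    (Matrix.of fun j k => pd (fun y => ip4 (pd f j y) (pd n k y)) i x -
      ip4 (pd (pd f j) i x) (pd n k x) - ip4 (pd (pd f k) i x) (pd n j x))
    (by rw [inducedMetric, Matrix.of_apply, S.ip33_pd_normalPoint hx, hpn (pd n 0 x),
          ip4_comm (pd n 0 x), ip4_comm (pd n 0 x), h10])
    (by rw [inducedMetric, Matrix.of_apply, S.ip33_pd_normalPoint hx, hpn (pd n 0 x),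
          ip4_comm (pd n 0 x), ip4_comm (pd n 0 x), h10])
    (by rw [inducedMetric, Matrix.of_apply, S.ip33_pd_normalPoint hx, hpn (pd n 1 x),
          ip4_comm (pd n 1 x), ip4_comm (pd n 1 x), ip4_comm (pd f 1 x) (pd f 0 x)])
    (by rw [inducedMetric, Matrix.of_apply, S.ip33_pd_normalPoint hx, hpn (pd n 1 x),
          ip4_comm (pd n 1 x), ip4_comm (pd n 1 x)])
    (by rw [Matrix.of_apply, hpn (pd (pd f 0) i x)]; ring)
    (by rw [Matrix.of_apply, hpn (pd (pd f 0) i x), hpn (pd (pd f 1) i x)])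
    (by rw [Matrix.of_apply, hpn (pd (pd f 0) i x), hpn (pd (pd f 1) i x), hk10]; ring)
    (by rw [Matrix.of_apply, hpn (pd (pd f 1) i x)]; ring)
  simp only [S.kahlerForm_lagHessian_expr hx]
  simp only [Matrix.of_apply] at key
  rw [key]
  congr 1 <;> ring

lemma ip4_combination_nonneg (s t : ℝ) :
    0 ≤ ip4 (s • pd f 0 x + t • pd f 1 x) (s • pd f 0 x + t • pd f 1 x) ∧
      (ip4 (s • pd f 0 x + t • pd f 1 x) (s • pd f 0 x + t • pd f 1 x) = 0 → s = 0 ∧ t = 0) := by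
  have hpos := S.pos x hx
  have hdet := S.det_pos x hx
  have key : ip4 (pd f 0 x) (pd f 0 x) *
      ip4 (s • pd f 0 x + t • pd f 1 x) (s • pd f 0 x + t • pd f 1 x) =
      (ip4 (pd f 0 x) (pd f 0 x) * s + ip4 (pd f 0 x) (pd f 1 x) * t) ^ 2 +
      (ip4 (pd f 0 x) (pd f 0 x) * ip4 (pd f 1 x) (pd f 1 x) -
        ip4 (pd f 0 x) (pd f 1 x) ^ 2) * t ^ 2 := by
    simp only [ip4_add_left, ip4_add_right, ip4_smul_left, ip4_smul_right,
      ip4_comm (pd f 1 x) (pd f 0 x)]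
    ring
  refine ⟨nonneg_of_mul_nonneg_right (by rw [key]; positivity) hpos, fun h0 => ?_⟩
  rw [h0, mul_zero] at key
  have ht : t = 0 := by
    by_contra ht
    have : 0 < t ^ 2 := by positivity
    nlinarith [sq_nonneg (ip4 (pd f 0 x) (pd f 0 x) * s + ip4 (pd f 0 x) (pd f 1 x) * t),
      mul_pos hdet this]
  subst ht
  have hs : ip4 (pd f 0 x) (pd f 0 x) * s = 0 := by
    have : (ip4 (pd f 0 x) (pd f 0 x) * s) ^ 2 = 0 := by linear_combination -key
    exact pow_eq_zero_iff two_ne_zero |>.1 this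
  exact ⟨(mul_eq_zero.1 hs).resolve_left hpos.ne', rfl⟩

/-- The partial derivatives of the Gauss map are linearly independent. -/
lemma pd_normalPoint_independent {s t : ℝ}
    (h : s • pd (fun y => normalPoint (n y) (f y)) 0 x +
      t • pd (fun y => normalPoint (n y) (f y)) 1 x = 0) : s = 0 ∧ t = 0 := by
  -- Pairing the combination with itself under `σ` gives the squared lengths of the corresponding
  -- derivatives of `f` and `n`.
  have h1 : ip4 (s • pd f 0 x + t • pd f 1 x) (s • pd f 0 x + t • pd f 1 x) +
      ip4 (s • pd n 0 x + t • pd n 1 x) (s • pd n 0 x + t • pd n 1 x) = 0 := by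
    have h2 : ∀ i, ip33 (s • pd (fun y => normalPoint (n y) (f y)) 0 x +
        t • pd (fun y => normalPoint (n y) (f y)) 1 x)
        (pd (fun y => normalPoint (n y) (f y)) i x) = 0 := by
      intro i
      rw [h]; simp [ip33, ip3]
    simp only [ip33_add_left, ip33_smul_left, S.ip33_pd_normalPoint hx] at h2
    simp only [ip4_add_left, ip4_add_right, ip4_smul_left, ip4_smul_right]
    linear_combination s * h2 0 + t * h2 1
  -- By the Weingarten equation this vector lies in the spacelike tangent plane.
  have h3 : 0 ≤ ip4 (s • pd n 0 x + t • pd n 1 x) (s • pd n 0 x + t • pd n 1 x) := by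
    obtain ⟨a, b, h0⟩ : ∃ a b : ℝ, pd n 0 x = a • pd f 0 x + b • pd f 1 x :=
      ⟨_, _, S.pd_n_eq hx 0⟩
    obtain ⟨c, d, h1⟩ : ∃ c d : ℝ, pd n 1 x = c • pd f 0 x + d • pd f 1 x :=
      ⟨_, _, S.pd_n_eq hx 1⟩
    have : s • pd n 0 x + t • pd n 1 x =
        (s * a + t * c) • pd f 0 x + (s * b + t * d) • pd f 1 x := by
      rw [h0, h1]; module
    rw [this]
    exact (S.ip4_combination_nonneg hx _ _).1
  obtain ⟨h4, h5⟩ := S.ip4_combination_nonneg hx s t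
  exact h5 (by linarith)

end IsLocalSurface

/-! ### Maps on a surface in charts -/

section Charts

variable {M : Type*} [TopologicalSpace M] [ChartedSpace E2 M] [IsManifold (𝓡 2) ∞ M]
  {V : Type*} [NormedAddCommGroup V] [NormedSpace ℝ V]

lemma contDiffAt_comp_chart_symm {f : M → V} (hf : ContMDiff (𝓡 2) 𝓘(ℝ, V) ∞ f)
    {e : OpenPartialHomeomorph M E2} (he : e ∈ atlas E2 M) {x : E2} (hx : x ∈ e.target) :
    ContDiffAt ℝ ∞ (fun y => f (e.symm y)) x := by
  have h1 : ContMDiffAt (𝓡 2) (𝓡 2) ∞ e.symm x :=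
    contMDiffAt_symm_of_mem_maximalAtlas (IsManifold.subset_maximalAtlas he) hx
  exact ((hf _).comp x h1).contDiffAt

lemma fderiv_comp_chart_symm {f : M → V} {e : OpenPartialHomeomorph M E2}
    (he : e ∈ atlas E2 M) {x : E2} (hx : x ∈ e.target)
    (hf : MDifferentiableAt (𝓡 2) 𝓘(ℝ, V) f (e.symm x)) (v : E2) :
    fderiv ℝ (fun y => f (e.symm y)) x v =
      mvfderiv (𝓡 2) f (e.symm x) (mfderiv (𝓡 2) (𝓡 2) e.symm x v) := by
  have he' : e.MDifferentiable (𝓡 2) (𝓡 2) :=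
    haveI : IsManifold (𝓡 2) 1 M := IsManifold.of_le (n := ∞) (by simp)
    mdifferentiable_of_mem_atlas he
  have h := mfderiv_comp x hf (he'.mdifferentiableAt_symm hx)
  rw [mfderiv_eq_fderiv] at h
  have h2 := congrArg (fun L => L v) h
  exact h2

lemma mfderiv_chart_symm_injective {e : OpenPartialHomeomorph M E2}
    (he : e ∈ atlas E2 M) {x : E2} (hx : x ∈ e.target) :
    Function.Injective (mfderiv (𝓡 2) (𝓡 2) e.symm x) := by
  have he' : e.MDifferentiable (𝓡 2) (𝓡 2) :=
    haveI : IsManifold (𝓡 2) 1 M := IsManifold.of_le (n := ∞) (by simp)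
    mdifferentiable_of_mem_atlas he
  exact he'.symm.mfderiv_injective hx

omit [IsManifold (𝓡 2) ∞ M] in
lemma basePt_mem (p : M) : basePt p ∈ (chartAt E2 p).target :=
  mem_chart_target E2 p

omit [IsManifold (𝓡 2) ∞ M] in
lemma chart_symm_basePt (p : M) : (chartAt E2 p).symm (basePt p) = p :=
  (chartAt E2 p).left_inv (mem_chart_source E2 p)

omit [IsManifold (𝓡 2) ∞ M] in
-- The preferred chart at `p` is the one that trivializes the tangent space at `p`, so no transition
-- derivative enters at this point.
lemma fderiv_localRep {f : M → V} {p : M} (hf : MDifferentiableAt (𝓡 2) 𝓘(ℝ, V) f p) :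
    fderiv ℝ (localRep f p) (basePt p) = mvfderiv (𝓡 2) f p := by
  have h := hf.mfderiv
  simp only [writtenInExtChartAt, extChartAt, mfld_simps, fderivWithin_univ] at h
  ext v
  exact (congrArg (fun L => L v) h).symm

lemma contMDiff_of_localRep {f : M → V}
    (h : ∀ p, ContDiffAt ℝ ∞ (localRep f p) (basePt p)) : ContMDiff (𝓡 2) 𝓘(ℝ, V) ∞ f := by
  intro p
  have h1 : ContMDiffAt (𝓡 2) (𝓡 2) ∞ (chartAt E2 p) p :=
    contMDiffAt_of_mem_maximalAtlas (IsManifold.chart_mem_maximalAtlas p) (mem_chart_source E2 p)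
  have h2 : ContMDiffAt (𝓡 2) 𝓘(ℝ, V) ∞ (localRep f p ∘ chartAt E2 p) p :=
    ContMDiffAt.comp p (h p).contMDiffAt h1
  refine h2.congr_of_eventuallyEq ?_
  filter_upwards [(chartAt E2 p).open_source.mem_nhds (mem_chart_source E2 p)] with q hq
  simp [localRep, (chartAt E2 p).left_inv hq]

lemma mvfderiv_mem_closedForms {φ : M → ℝ} (hφ : ContMDiff (𝓡 2) 𝓘(ℝ, ℝ) ∞ φ) :
    (mvfderiv (𝓡 2) φ : OneForm M) ∈ closedForms M := by
  intro e he
  have hc : ∀ x ∈ e.target, ContDiffAt ℝ ∞ (fun y => φ (e.symm y)) x :=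
    fun x hx => contDiffAt_comp_chart_symm hφ he hx
  have heq : ∀ x ∈ e.target, OneForm.inChart (mvfderiv (𝓡 2) φ : OneForm M) e x =
      fderiv ℝ (fun y => φ (e.symm y)) x := by
    intro x hx
    ext v
    rw [fderiv_comp_chart_symm he hx ((hφ _).mdifferentiableAt (by simp))]
    rfl
  refine ⟨fun x hx => ?_, fun x hx u v => ?_⟩
  · exact (((hc x hx).fderiv_right (m := ∞) le_rfl).contDiffWithinAt).congr heq (heq x hx)
  · rw [Filter.EventuallyEq.fderiv_eq
      (Filter.eventually_of_mem (e.open_target.mem_nhds hx) heq), sub_eq_zero]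
    have hs : IsSymmSndFDerivAt ℝ (fun y => φ (e.symm y)) x := (hc x hx).isSymmSndFDerivAt
      (by simpa using WithTop.coe_le_coe.2 (le_top : (2 : ℕ∞) ≤ ⊤))
    exact hs.eq u v

end Charts

/-! ### Spacelike surfaces and their unit normals in charts -/

section Surfaces

variable {M : Type*} [TopologicalSpace M] [ChartedSpace E2 M] [IsManifold (𝓡 2) ∞ M]
  {F ν : M → R4}

/-- The orthogonal projection of `t` to the normal space of the plane spanned by `a, b`. -/
def planeComplementProj (a b t : R4) : R4 :=
  t - ((ip4 b b * ip4 t a - ip4 a b * ip4 t b) / (ip4 a a * ip4 b b - ip4 a b ^ 2)) • a -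
    ((ip4 a a * ip4 t b - ip4 a b * ip4 t a) / (ip4 a a * ip4 b b - ip4 a b ^ 2)) • b

/-- The time field is orthogonal to `x`, so its part normal to the plane is a multiple of `n`,
positive by the future condition. Normalizing it gives a formula for `n` in terms of `F` and its
first derivatives; smoothness of the unit normal, which is not assumed, follows from it. -/
lemma IsNormalFrame.eq_smul_planeComplementProj {a b n x : R4} (h : IsNormalFrame a b n x)
    (hd : ip4 a a * ip4 b b - ip4 a b ^ 2 ≠ 0) (hT : ip4 n (timeField x) < 0) :
    0 < -ip4 (planeComplementProj a b (timeField x)) (planeComplementProj a b (timeField x)) ∧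
    n = (1 / √(-ip4 (planeComplementProj a b (timeField x))
      (planeComplementProj a b (timeField x)))) • planeComplementProj a b (timeField x) := by
  have hxT : ip4 (timeField x) x = 0 := by simp [ip4, timeField]; ring
  obtain ⟨t, ht⟩ : ∃ t, t = timeField x := ⟨_, rfl⟩
  rw [← ht] at hxT hT ⊢
  have key : planeComplementProj a b t + ip4 t n • n = 0 := by
    apply h.eq_zero hd
    · rw [ip4_add_left, ip4_smul_left, planeComplementProj, ip4_sub_left, ip4_sub_left,
        ip4_smul_left, ip4_smul_left, h.na, ip4_comm b a]
      generalize hdet : ip4 a a * ip4 b b - ip4 a b ^ 2 = d at *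
      field_simp
      rw [← hdet]
      ring
    · rw [ip4_add_left, ip4_smul_left, planeComplementProj, ip4_sub_left, ip4_sub_left,
        ip4_smul_left, ip4_smul_left, h.nb]
      generalize hdet : ip4 a a * ip4 b b - ip4 a b ^ 2 = d at *
      field_simp
      rw [← hdet]
      ring
    · rw [ip4_add_left, ip4_smul_left, planeComplementProj, ip4_sub_left, ip4_sub_left,
        ip4_smul_left, ip4_smul_left, h.an, h.bn, h.nn]
      ring
    · rw [ip4_add_left, ip4_smul_left, planeComplementProj, ip4_sub_left, ip4_sub_left,
        ip4_smul_left, ip4_smul_left, h.ax, h.bx, h.nx, hxT]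
      ring
  have hm : planeComplementProj a b t = (-ip4 t n) • n := by
    rw [neg_smul]; exact eq_neg_of_add_eq_zero_left key
  have hpos : 0 < -ip4 t n := by rw [ip4_comm]; linarith
  have hsq : -ip4 (planeComplementProj a b t) (planeComplementProj a b t) = (-ip4 t n) ^ 2 := by
    rw [hm, ip4_smul_left, ip4_smul_right, h.nn]; ring
  rw [hsq, Real.sqrt_sq hpos.le, hm, smul_smul, one_div, inv_mul_cancel₀ hpos.ne', one_smul]
  exact ⟨by positivity, rfl⟩

variable (hF : IsSpacelikeImmersion F) (hν : IsFutureUnitNormal F ν)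
include hF

lemma IsSpacelikeImmersion.spacelike_chart {e : OpenPartialHomeomorph M E2}
    (he : e ∈ atlas E2 M) {x : E2} (hx : x ∈ e.target) {v : E2} (hv : v ≠ 0) :
    0 < ip4 (fderiv ℝ (fun y => F (e.symm y)) x v) (fderiv ℝ (fun y => F (e.symm y)) x v) := by
  rw [fderiv_comp_chart_symm he hx ((hF.smooth _).mdifferentiableAt (by simp))]
  apply hF.spacelike
  intro h0
  exact hv (mfderiv_chart_symm_injective he hx (h0.trans (map_zero _).symm))

lemma IsSpacelikeImmersion.metric_pos_chart {e : OpenPartialHomeomorph M E2}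
    (he : e ∈ atlas E2 M) {x : E2} (hx : x ∈ e.target) :
    0 < ip4 (pd (fun y => F (e.symm y)) 0 x) (pd (fun y => F (e.symm y)) 0 x) ∧
    0 < ip4 (pd (fun y => F (e.symm y)) 0 x) (pd (fun y => F (e.symm y)) 0 x) *
      ip4 (pd (fun y => F (e.symm y)) 1 x) (pd (fun y => F (e.symm y)) 1 x) -
      ip4 (pd (fun y => F (e.symm y)) 0 x) (pd (fun y => F (e.symm y)) 1 x) ^ 2 := by
  have h := fun v => hF.spacelike_chart he hx (v := v)
  simp only [fderiv_eq_pd] at h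
  generalize pd (fun y => F (e.symm y)) 0 x = a at h ⊢
  generalize pd (fun y => F (e.symm y)) 1 x = b at h ⊢
  have ha : 0 < ip4 a a := by
    have := h (basisVec 0) (by
      intro h0; have := congrArg (fun w : E2 => w 0) h0; simp [basisVec] at this)
    simpa [basisVec] using this
  refine ⟨ha, ?_⟩
  -- The test vector maps to `⟨a,a⟩` times the component of `b` orthogonal to `a`; its squared
  -- length is `⟨a,a⟩` times the Gram determinant.
  have h1 := h (-ip4 a b • basisVec 0 + ip4 a a • basisVec 1) (by
      intro h0; have := congrArg (fun w : E2 => w 1) h0; simp [basisVec] at this; exact ha.ne' this)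
  simp [basisVec] at h1
  have h2 : 0 < ip4 a a * (ip4 a a * ip4 b b - ip4 a b ^ 2) := by
    refine lt_of_lt_of_eq h1 ?_
    rw [← neg_smul]
    simp only [ip4_add_left, ip4_add_right, ip4_smul_left, ip4_smul_right, ip4_comm b a]
    ring
  exact pos_of_mul_pos_right h2 ha.le

include hν

lemma isNormalFrame_chart {e : OpenPartialHomeomorph M E2} (he : e ∈ atlas E2 M) {x : E2}
    (hx : x ∈ e.target) :
    IsNormalFrame (pd (fun y => F (e.symm y)) 0 x) (pd (fun y => F (e.symm y)) 1 x)
      (ν (e.symm x)) (F (e.symm x)) := by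
  have hn : ∀ i, ip4 (ν (e.symm x)) (pd (fun y => F (e.symm y)) i x) = 0 := by
    intro i
    rw [pd, fderiv_comp_chart_symm he hx ((hF.smooth _).mdifferentiableAt (by simp))]
    exact hν.normal _ _
  have hdiff := (contDiffAt_comp_chart_symm hF.smooth he hx).differentiableAt (by simp)
  have hx' : ∀ i, ip4 (F (e.symm x)) (pd (fun y => F (e.symm y)) i x) = 0 := by
    intro i
    have h := pd_ip4 hdiff hdiff i
    rw [pd_congr e.open_target (g := fun _ => -1) (fun y _ => hF.mem_AdS3 _) hx, pd_const,
      ip4_comm (pd _ i x)] at h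
    linarith
  exact ⟨hν.unit _, hF.mem_AdS3 _, hν.tangent_AdS3 _, hn 0, hn 1, hx' 0, hx' 1⟩

lemma contDiffAt_normal_chart {e : OpenPartialHomeomorph M E2} (he : e ∈ atlas E2 M) {x : E2}
    (hx : x ∈ e.target) : ContDiffAt ℝ ∞ (fun y => ν (e.symm y)) x := by
  set f : E2 → R4 := fun y => F (e.symm y) with hf
  have hfc : ContDiffAt ℝ ∞ f x := contDiffAt_comp_chart_symm hF.smooth he hx
  have hdet : ∀ y ∈ e.target, ip4 (pd f 0 y) (pd f 0 y) * ip4 (pd f 1 y) (pd f 1 y) -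
      ip4 (pd f 0 y) (pd f 1 y) ^ 2 ≠ 0 := fun y hy => (hF.metric_pos_chart he hy).2.ne'
  have hrepr : ∀ y ∈ e.target, _ := fun y hy =>
    (isNormalFrame_chart hF hν he hy).eq_smul_planeComplementProj (hdet y hy) (hν.future _)
  have hT : ContDiffAt ℝ ∞ (fun y => timeField (f y)) x := by
    rw [contDiffAt_pi]
    have hc := contDiffAt_pi.1 hfc
    intro i
    fin_cases i
    exacts [contDiffAt_const, contDiffAt_const, hc 3, (hc 2).neg]
  have hip : ∀ {v w : E2 → R4}, ContDiffAt ℝ ∞ v x → ContDiffAt ℝ ∞ w x →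
      ContDiffAt ℝ ∞ (fun y => ip4 (v y) (w y)) x := fun hv hw => contDiffAt_bilin ip4Bilin hv hw
  have h0 := contDiffAt_pd hfc 0
  have h1 := contDiffAt_pd hfc 1
  have hd := ((hip h0 h0).mul (hip h1 h1)).sub ((hip h0 h1).pow 2)
  have hm : ContDiffAt ℝ ∞ (fun y => planeComplementProj (pd f 0 y) (pd f 1 y)
      (timeField (f y))) x :=
    (hT.sub (((((hip h1 h1).mul (hip hT h0)).sub ((hip h0 h1).mul (hip hT h1))).div hd
      (hdet x hx)).smul h0)).sub
      (((((hip h0 h0).mul (hip hT h1)).sub ((hip h0 h1).mul (hip hT h0))).div hd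
      (hdet x hx)).smul h1)
  have hpos := (hrepr x hx).1
  have hs := ((hip hm hm).neg).sqrt hpos.ne'
  refine ((contDiffAt_const.div hs (Real.sqrt_pos.2 hpos).ne').smul hm).congr_of_eventuallyEq
    (Filter.eventually_of_mem (e.open_target.mem_nhds hx) fun y hy => (hrepr y hy).2)

/-- The future directed unit normal is smooth. -/
lemma contMDiff_normal : ContMDiff (𝓡 2) 𝓘(ℝ, R4) ∞ ν :=
  contMDiff_of_localRep fun p =>
    contDiffAt_normal_chart hF hν (chart_mem_atlas E2 p) (basePt_mem p)

lemma isLocalSurface_chart {e : OpenPartialHomeomorph M E2} (he : e ∈ atlas E2 M) :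
    IsLocalSurface e.target (fun y => F (e.symm y)) (fun y => ν (e.symm y)) where
  isOpen := e.open_target
  smooth_f _ hx := contDiffAt_comp_chart_symm hF.smooth he hx
  smooth_n _ hx := contDiffAt_normal_chart hF hν he hx
  frame _ hx := isNormalFrame_chart hF hν he hx
  pos _ hx := (hF.metric_pos_chart he hx).1
  det_pos _ hx := (hF.metric_pos_chart he hx).2

lemma isLocalSurface_localRep (p : M) :
    IsLocalSurface (chartAt E2 p).target (localRep F p) (localRep ν p) :=
  isLocalSurface_chart hF hν (chart_mem_atlas E2 p)

end Surfaces

/-! ### The Gauss map and the Lagrangian angle on the surface -/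

section GaussMap

variable {M : Type*} [TopologicalSpace M] [ChartedSpace E2 M] [IsManifold (𝓡 2) ∞ M]
  {F ν : M → R4} (hF : IsSpacelikeImmersion F) (hν : IsFutureUnitNormal F ν)

omit [IsManifold (𝓡 2) ∞ M] in
lemma pd_localRep {V : Type*} [NormedAddCommGroup V] [NormedSpace ℝ V] {f : M → V}
    (hf : ContMDiff (𝓡 2) 𝓘(ℝ, V) ∞ f) (p : M) (i : Fin 2) :
    pd (localRep f p) i (basePt p) = mvfderiv (𝓡 2) f p (basisVec i) := by
  rw [pd, fderiv_localRep ((hf p).mdifferentiableAt (by simp))]; rfl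

include hF hν

lemma isNormalFrame_mvfderiv (p : M) :
    IsNormalFrame (mvfderiv (𝓡 2) F p (basisVec 0)) (mvfderiv (𝓡 2) F p (basisVec 1))
      (ν p) (F p) := by
  have h := (isLocalSurface_localRep hF hν p).frame _ (basePt_mem p)
  rw [pd_localRep hF.smooth, pd_localRep hF.smooth] at h
  simpa only [localRep, chart_symm_basePt] using h

/-- The squared determinant of the frame is `det g`, so the sign and the square root recombine to
the determinant itself. -/
lemma areaOfBasis_eq_det4 (p : M) :
    areaOfBasis F ν p =
      det4 (mvfderiv (𝓡 2) F p (basisVec 0)) (mvfderiv (𝓡 2) F p (basisVec 1)) (ν p) (F p) := by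
  have h := (isNormalFrame_mvfderiv hF hν p).det4_sq
  have hg : (firstFundamentalForm F p).det =
      det4 (mvfderiv (𝓡 2) F p (basisVec 0)) (mvfderiv (𝓡 2) F p (basisVec 1)) (ν p) (F p) ^ 2 := by
    rw [h, firstFundamentalForm, inducedMetric, Matrix.det_fin_two]
    simp only [Matrix.of_apply, pd_localRep hF.smooth]
    rw [ip4_comm (mvfderiv (𝓡 2) F p (basisVec 1)) (mvfderiv (𝓡 2) F p (basisVec 0))]
    ring
  rw [areaOfBasis, hg, Real.sqrt_sq_eq_abs]
  exact sign_mul_abs _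

/-- The Gauss map in terms of the oriented normal plane spanned by `ν, F`. -/
lemma gaussMap_eq_normalPoint (p : M) : gaussMap F ν p = normalPoint (ν p) (F p) := by
  have hfr := isNormalFrame_mvfderiv hF hν p
  have hD : det4 (mvfderiv (𝓡 2) F p (basisVec 0)) (mvfderiv (𝓡 2) F p (basisVec 1))
      (ν p) (F p) ≠ 0 := by
    have h := ((isLocalSurface_localRep hF hν p).det_pos _ (basePt_mem p)).ne'
    rw [pd_localRep hF.smooth, pd_localRep hF.smooth, ← hfr.det4_sq] at h
    exact fun h0 => h (by rw [h0]; ring)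
  ext A
  · simp only [gaussMap, gaussComponent, normalPoint, bivector, areaOfBasis_eq_det4 hF hν,
      Pi.smul_apply, smul_eq_mul]
    rw [hfr.omega_tangent 1 (by norm_num)]
    field_simp
  · simp only [gaussMap, gaussComponent, normalPoint, bivector, areaOfBasis_eq_det4 hF hν,
      Pi.smul_apply, smul_eq_mul]
    rw [hfr.omega_tangent (-1) (by norm_num)]
    field_simp

lemma localRep_gaussMap (p : M) : localRep (gaussMap F ν) p =
    fun y => normalPoint (localRep ν p y) (localRep F p y) :=
  funext fun _ => gaussMap_eq_normalPoint hF hν _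

lemma contMDiff_gaussMap : ContMDiff (𝓡 2) 𝓘(ℝ, R33) ∞ (gaussMap F ν) := by
  refine contMDiff_of_localRep fun p => ?_
  have S := isLocalSurface_localRep hF hν p
  rw [localRep_gaussMap hF hν]
  exact contDiffAt_bilin normalPointBilin (S.smooth_n _ (basePt_mem p))
    (S.smooth_f _ (basePt_mem p))

lemma mvfderiv_gaussMap (p : M) (v : TangentSpace (𝓡 2) p) :
    mvfderiv (𝓡 2) (gaussMap F ν) p v =
      (show E2 from v) 0 • pd (fun y => normalPoint (localRep ν p y) (localRep F p y)) 0 (basePt p) +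
      (show E2 from v) 1 •
        pd (fun y => normalPoint (localRep ν p y) (localRep F p y)) 1 (basePt p) := by
  have h := fderiv_eq_pd (x := basePt p) (localRep (gaussMap F ν) p) v
  rw [fderiv_localRep ((contMDiff_gaussMap hF hν p).mdifferentiableAt (by simp)),
    localRep_gaussMap hF hν] at h
  exact h

lemma gaussMap_basePt (p : M) : gaussMap F ν p =
    normalPoint (localRep ν p (basePt p)) (localRep F p (basePt p)) := by
  rw [gaussMap_eq_normalPoint hF hν, localRep, localRep, chart_symm_basePt]

lemma isLagrangianImmersion_gaussMap : IsLagrangianImmersion (gaussMap F ν) where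
  smooth := contMDiff_gaussMap hF hν
  mem_grassmannian p := by
    rw [gaussMap_eq_normalPoint hF hν]
    exact normalPoint_mem_grassmannian (hν.unit p) (hF.mem_AdS3 p) (hν.tangent_AdS3 p) (hν.future p)
  immersion p := by
    have S := isLocalSurface_localRep hF hν p
    have hx := basePt_mem p
    rw [injective_iff_map_eq_zero]
    intro v hv
    rw [mvfderiv_gaussMap hF hν] at hv
    obtain ⟨h0, h1⟩ := S.pd_normalPoint_independent hx hv
    refine (eq_sum_basisVec v).trans ?_
    rw [h0, h1, zero_smul, zero_smul, add_zero]
    rfl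
  lagrangian p u v := by
    have S := isLocalSurface_localRep hF hν p
    have hx := basePt_mem p
    rw [gaussMap_basePt hF hν, mvfderiv_gaussMap hF hν, mvfderiv_gaussMap hF hν]
    have hsmul : ∀ (c : ℝ) (P X Y : R33), kahlerForm P (c • X) Y = c * kahlerForm P X Y := by
      intro c P X Y
      simp [kahlerForm, ip33, ip3, complexJ, lorentzCross]; ring
    simp only [kahlerForm_add_left, kahlerForm_add_right, hsmul, kahlerForm_smul_right,
      S.kahlerForm_pd_normalPoint hx]
    ring

/-- The Christoffel terms are tangential and drop out against `ν`; the rest is `⟨ν, ∂ⱼF⟩ = 0`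
differentiated. -/
lemma secondFundamentalForm_eq (p : M) :
    secondFundamentalForm F ν p = secondForm (localRep F p) (localRep ν p) (basePt p) := by
  have S := isLocalSurface_localRep hF hν p
  have hx := basePt_mem p
  have hνp : ν p = localRep ν p (basePt p) := by rw [localRep, chart_symm_basePt]
  ext i j
  simp only [secondFundamentalForm, secondForm, Matrix.of_apply, secondFundamentalTensor]
  rw [S.pd_f_pd_n_comm hx, S.pd_f_pd_n hx, hνp, ip4_sub_left, Fin.sum_univ_two, ip4_add_left,
    ip4_smul_left, ip4_smul_left, (S.frame _ hx).an, (S.frame _ hx).bn]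
  ring

/-- The principal curvatures are real, and the sum of their arcus tangents is the argument of a
smooth function in local coordinates. -/
lemma exists_principalCurvatures (p : M) :
    ∃ l m : ℝ, l ≤ m ∧ principalCurvatures F ν p = {l, m} ∧
      Real.arctan l + Real.arctan m =
        Complex.arg (localAngleNumber (localRep F p) (localRep ν p) (basePt p)) := by
  have S := isLocalSurface_localRep hF hν p
  have hx := basePt_mem p
  obtain ⟨l, m, hlm, hroots, -, harg⟩ := exists_eigenvalues
    (g := inducedMetric ip4 (localRep F p) (basePt p))
    (h := secondForm (localRep F p) (localRep ν p) (basePt p)) (ip4_comm _ _)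
    (S.pd_f_pd_n_comm hx 1 0) (S.pos _ hx) (S.det_inducedMetric_pos hx)
  refine ⟨l, m, hlm, ?_, harg⟩
  rw [principalCurvatures, weingarten, secondFundamentalForm_eq hF hν]
  exact hroots

/-- The angle at each point is computed in the preferred chart of that point, which varies. The
comparison with one fixed chart is what allows the angle to be differentiated. -/
lemma arg_localAngleNumber_chart (p : M) {x : E2} (hx : x ∈ (chartAt E2 p).target) :
    Complex.arg (localAngleNumber (localRep F p) (localRep ν p) x) =
      Complex.arg (localAngleNumber (localRep F ((chartAt E2 p).symm x))
        (localRep ν ((chartAt E2 p).symm x)) (basePt ((chartAt E2 p).symm x))) := by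
  set q := (chartAt E2 p).symm x with hq
  have S := isLocalSurface_localRep hF hν p
  let L : E2 → E2 := fun v => mfderiv (𝓡 2) (𝓡 2) (chartAt E2 p).symm x v
  -- The Jacobian matrix between the two charts; both fundamental forms transform by congruence with
  -- it.
  let C : Matrix (Fin 2) (Fin 2) ℝ := Matrix.of fun i j => L (basisVec j) i
  have hν' := contMDiff_normal hF hν
  have hpd : ∀ {f : M → R4}, ContMDiff (𝓡 2) 𝓘(ℝ, R4) ∞ f → ∀ j,
      pd (localRep f p) j x = C 0 j • pd (localRep f q) 0 (basePt q) +
        C 1 j • pd (localRep f q) 1 (basePt q) := by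
    intro f hf j
    have h1 := fderiv_comp_chart_symm (chart_mem_atlas E2 p) hx
      ((hf _).mdifferentiableAt (by simp)) (basisVec j)
    rw [← fderiv_localRep ((hf _).mdifferentiableAt (by simp))] at h1
    exact h1.trans (fderiv_eq_pd _ (L (basisVec j)))
  have hg : inducedMetric ip4 (localRep F p) x =
      C.transpose * inducedMetric ip4 (localRep F q) (basePt q) * C := by
    ext i j
    simp only [inducedMetric, Matrix.of_apply, Matrix.mul_apply, Matrix.transpose_apply,
      Fin.sum_univ_two, hpd hF.smooth, ip4_add_left, ip4_add_right, ip4_smul_left, ip4_smul_right]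
    ring
  have hh : secondForm (localRep F p) (localRep ν p) x =
      C.transpose * secondForm (localRep F q) (localRep ν q) (basePt q) * C := by
    ext i j
    simp only [secondForm, Matrix.of_apply, Matrix.mul_apply, Matrix.transpose_apply,
      Fin.sum_univ_two, hpd hF.smooth, hpd hν', ip4_add_left, ip4_add_right, ip4_smul_left,
      ip4_smul_right]
    ring
  have hC : C.det ≠ 0 := by
    have h := S.det_inducedMetric_pos hx
    rw [hg, Matrix.det_mul] at h
    exact right_ne_zero_of_mul h.ne'
  rw [localAngleNumber, hg, hh, angleNumber_congruence, Complex.arg_real_mul _ (by positivity)]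
  rfl

end GaussMap

end AdSGauss

end

open AdSGauss in
theorem lemmaA2 {M : Type*} [TopologicalSpace M] [ChartedSpace (EuclideanSpace ℝ (Fin 2)) M]
    [IsManifold (𝓡 2) ∞ M] (F ν : M → AdSGauss.R4) (hF : AdSGauss.IsSpacelikeImmersion F)
    (hν : AdSGauss.IsFutureUnitNormal F ν) :
    AdSGauss.IsLagrangianImmersion (AdSGauss.gaussMap F ν) ∧
    (∃ hτ : AdSGauss.meanCurvatureForm (AdSGauss.gaussMap F ν) ∈ AdSGauss.closedForms M,
      AdSGauss.maslovClass (AdSGauss.gaussMap F ν) hτ = 0) ∧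
    ∃ lam₁ lam₂ : M → ℝ,
      (∀ p, lam₁ p ≤ lam₂ p ∧ AdSGauss.principalCurvatures F ν p = {lam₁ p, lam₂ p}) ∧
      AdSGauss.IsLagrangianAngle (AdSGauss.gaussMap F ν)
        (fun p => Real.arctan (lam₁ p) + Real.arctan (lam₂ p)) := by
  -- The principal curvatures are chosen pointwise, with no regularity; only the sum of their
  -- arctangents is shown to be smooth.
  choose lam₁ lam₂ hle hroots harg using exists_principalCurvatures hF hν
  have hrep : ∀ (p : M), ∀ x ∈ (chartAt (EuclideanSpace ℝ (Fin 2)) p).target,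
      localRep (fun p => Real.arctan (lam₁ p) + Real.arctan (lam₂ p)) p x =
        Complex.arg (localAngleNumber (localRep F p) (localRep ν p) x) := fun p x hx =>
    (harg _).trans (arg_localAngleNumber_chart hF hν p hx).symm
  have hsmooth : ContMDiff (𝓡 2) 𝓘(ℝ, ℝ) ∞
      (fun p => Real.arctan (lam₁ p) + Real.arctan (lam₂ p)) := by
    refine contMDiff_of_localRep fun p => ?_
    have S := isLocalSurface_localRep hF hν p
    have hx := basePt_mem p
    refine ((contDiffAt_arg (S.localAngleNumber_mem_slitPlane hx)).comp _
      (S.contDiffAt_localAngleNumber hx)).congr_of_eventuallyEq ?_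
    exact Filter.eventually_of_mem (S.isOpen.mem_nhds hx) (hrep p)
  have hform : meanCurvatureForm (gaussMap F ν) =
      mvfderiv (𝓡 2) (fun p => Real.arctan (lam₁ p) + Real.arctan (lam₂ p)) := by
    funext p
    have S := isLocalSurface_localRep hF hν p
    have hx := basePt_mem p
    have hcoeff : ∀ i, meanCurvatureCoeff (gaussMap F ν) p i =
        mvfderiv (𝓡 2) (fun p => Real.arctan (lam₁ p) + Real.arctan (lam₂ p)) p (basisVec i) := by
      intro i
      rw [← pd_localRep hsmooth, pd_congr S.isOpen (hrep p) hx,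
        ← S.meanCurvature_eq_pd_arg hx (fun l j k => christoffel (inducedMetric ip33
          (fun y => normalPoint (localRep ν p y) (localRep F p y))) (basePt p) l j k) i]
      simp only [meanCurvatureCoeff, lagMetric, lagSecondFundamental, lagHessian,
        localRep_gaussMap hF hν, gaussMap_basePt hF hν]
    ext v
    have hv := fderiv_eq_pd (x := basePt p)
      (localRep (fun p => Real.arctan (lam₁ p) + Real.arctan (lam₂ p)) p) v
    rw [fderiv_localRep ((hsmooth p).mdifferentiableAt (by simp)), pd_localRep hsmooth,
      pd_localRep hsmooth, ← hcoeff, ← hcoeff] at hv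
    refine Eq.trans ?_ hv.symm
    have hsum : meanCurvatureForm (gaussMap F ν) p v = (∑ i : Fin 2,
        meanCurvatureCoeff (gaussMap F ν) p i • (EuclideanSpace.proj i : E2 →L[ℝ] ℝ)) v := rfl
    rw [hsum, Fin.sum_univ_two]
    exact congrArg₂ (fun a b : ℝ => a + b) (mul_comm _ _) (mul_comm _ _)
  have hclosed : meanCurvatureForm (gaussMap F ν) ∈ closedForms M := by
    rw [hform]; exact mvfderiv_mem_closedForms hsmooth
  refine ⟨isLagrangianImmersion_gaussMap hF hν, ⟨hclosed, ?_⟩, lam₁, lam₂,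
    fun p => ⟨hle p, hroots p⟩, hsmooth, hform⟩
  rw [maslovClass, Submodule.Quotient.mk_eq_zero]
  -- `τ = dφ` with `φ` globally defined, so `τ/π` is exact.
  exact (exactForms M).smul_mem _ ⟨_, hsmooth, hform.symm⟩
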